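/- All graphs are finite and simple. Let $G$ be a maximal planar graph, that is, a planar graph to which no new edge can be added without violating planarity. For a set $S$ of vertices, let $\Gamma(S)$ be the set of vertices outside $S$ that have a neighbour in $S$. (1) Let $P=v_1v_2\cdots v_m$ $(m\ge 1)$ be an induced path of $G$ such that the subgraph $C=G[\Gamma(\{v_1,\dots,v_m\})]$ is a cycle (of length at least $3$). Then $$|C|=\sum_{i=1}^m d_G(v_i)-4(m-1),$$ and $C$ is an even cycle if and only if the number of odd-degree (in $G$) vertices among $v_1,\dots,v_m$ is even. (2) Let $H=G[\{v_1,\dots,v_m\}]$ ($v_1,\dots,v_m$ distinct) be a connected induced subgraph of $G$ such that the subgraph $C=G[\Gamma(\{v_1,\dots,v_m\})]$ is a cycle (of length at least $3$). Fix any embedding of $G$ in the sphere, and let $b(H)$ be the number of edges on the boundary of $H$, that is, edges of $H$ incident with a face of $H$ containing vertices of $G$ outside $H$, where the cut edges (bridges) of $H$ are counted twice. Then $$|C|=\sum_{i=1}^m d_G(v_i)-\sum_{i=1}^m d_H(v_i)-b(H),$$ and $C$ is an even cycle if and only if $b(H)$ and the number of odd-degree (in $G$) vertices among $v_1,\dots,v_m$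 have the same parity. -/

import Mathlib

namespace SimpleGraph

variable {V : Type*}

/-- A rotation system (combinatorial embedding) of `G` in an oriented closed surface: for every
vertex a cyclic order of the darts (directed edges) leaving it. `next d` is the dart that follows
`d` around its initial vertex. -/
structure RotationSystem (G : SimpleGraph V) where
  next : Equiv.Perm G.Dart
  fst_next : ∀ d : G.Dart, (next d).fst = d.fst
  sameCycle_next : ∀ d d' : G.Dart, d.fst = d'.fst → next.SameCycle d d'

namespace RotationSystem

variable {G : SimpleGraph V}

/-- Walk along the dart `d`, and leave its end by the dart that comes next after the reversed
dart. The orbits are the boundary walks of the faces. -/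
def facePerm (R : G.RotationSystem) : Equiv.Perm G.Dart :=
  (Function.Involutive.toPerm Dart.symm Dart.symm_involutive).trans R.next

/-- The boundary walks of the faces, one for each face that is incident with an edge. -/
def FaceWalk (R : G.RotationSystem) : Type _ :=
  Quotient (Equiv.Perm.SameCycle.setoid R.facePerm)

/-- The vertex `v` lies on the boundary of the face to which the dart `d` belongs. -/
def OnFaceOf (R : G.RotationSystem) (d : G.Dart) (v : V) : Prop :=
  ∃ d' : G.Dart, R.facePerm.SameCycle d d' ∧ d'.fst = v

/-- The rotation system has genus zero, that is, it embeds every connected component of `G` in a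
sphere: the Euler characteristics of the components add up to twice their number. A component
that is a single vertex has no darts and contributes one vertex and one face. -/
def IsPlanar (R : G.RotationSystem) : Prop :=
  Nat.card V + (Nat.card R.FaceWalk + {v : V | G.IsIsolated v}.ncard) =
    G.edgeSet.ncard + 2 * Nat.card G.ConnectedComponent

/-- The edges on the boundary of the induced subgraph `H = G[S]` in the given embedding of `G`:
the edges of `H` incident with a face of `H` that contains a vertex of `G` outside `H`.
Since `H` is induced, every edge of `G` that is not in `H` has an end outside `S`, so such a face
of `H` is made up of the faces of `G` that have a vertex outside `S` on their boundary, and an edge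
of `H` is incident with it exactly when one of the (at most two) faces of `G` at this edge has a
vertex outside `S`. -/
def boundaryEdges (R : G.RotationSystem) (S : Set V) : Set (Sym2 S) :=
  {e | e ∈ (G.induce S).edgeSet ∧
    ∃ d : G.Dart, d.edge = e.map Subtype.val ∧ ∃ v, v ∉ S ∧ R.OnFaceOf d v}

/-- The number of edges on the boundary of `H = G[S]`, the cut edges of `H` counted twice. -/
noncomputable def boundaryLength (R : G.RotationSystem) (S : Set V) : ℕ :=
  (R.boundaryEdges S).ncard + {e ∈ R.boundaryEdges S | (G.induce S).IsBridge e}.ncard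

end RotationSystem

/-- A (finite) graph is planar if it has a combinatorial embedding of genus zero. -/
def IsPlanar (G : SimpleGraph V) : Prop :=
  ∃ R : G.RotationSystem, R.IsPlanar

/-- A planar graph to which no edge can be added without violating planarity. -/
def IsMaximalPlanar (G : SimpleGraph V) : Prop :=
  G.IsPlanar ∧ ∀ G' : SimpleGraph V, G < G' → ¬ G'.IsPlanar

/-- The neighbour set of a set `S` of vertices: the vertices outside `S` with a neighbour in `S`. -/
def nbrSet (G : SimpleGraph V) (S : Set V) : Set V :=
  {w | w ∉ S ∧ ∃ v ∈ S, G.Adj v w}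

/-- The subgraph of `G` induced by `T` is a cycle of length `k`. -/
def InducesCycle (G : SimpleGraph V) (T : Set V) (k : ℕ) : Prop :=
  3 ≤ k ∧ Nonempty (G.induce T ≃g cycleGraph k)

end SimpleGraph

/-! The faces of a maximal planar graph are triangles, except where a component is a single edge.
The number of darts leaving `S` is the sum of the `G`-degrees minus the sum of the `H`-degrees. A
triangle that meets both `S` and its complement contains exactly one such dart, and it contains
either one dart inside `S` with third vertex outside (an inner dart) or one dart outside `S` with
third vertex in `S` (an outer dart). Hence `#outDarts = #innerDarts + #outerDarts`. It remains to
see that there are `|C|` outer darts and `b(H)` inner darts.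

Both counts need a form of the Jordan curve theorem. In genus zero every circulation is the
coboundary of a potential on faces (`exists_face_potential`). If the circulation avoids a connected
vertex set, the potential is constant on all faces at that set, so the circulation vanishes on an
edge with such faces on both sides (`circulation_eq_zero`). For the circulation along `C` and the
connected set `S`, this says that no edge of `C` is outer in both directions. For closed walks in
`H` and the connected set `C`, it says that an edge of `H` that is inner in both directions is a
bridge.

The potential comes from a dimension count over `ℚ`, which also yields the Euler inequality
`euler_le` for every rotation system. By that inequality a chord drawn inside a face preserves genus
zero, so by maximality distinct vertices on a face are adjacent, and this forces triangles.

An induced path contains no triangle, so all its `2(m-1)` darts are inner. The parity claims follow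
from the length formulas, since a sum of degrees has the parity of its number of odd terms. -/

namespace SimpleGraph.RotationSystem

/-! ### Coboundaries, the Euler inequality and face potentials -/

open Finset

variable {V : Type*} {G : SimpleGraph V} (R : G.RotationSystem)

/-- The face to which a dart belongs. -/
def face (d : G.Dart) : R.FaceWalk :=
  Quotient.mk (Equiv.Perm.SameCycle.setoid R.facePerm) d

theorem face_eq_iff {d d' : G.Dart} : R.face d = R.face d' ↔ R.facePerm.SameCycle d d' :=
  Quotient.eq (r := Equiv.Perm.SameCycle.setoid R.facePerm)

theorem face_surjective : Function.Surjective R.face :=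
  Quotient.mk_surjective

@[simp] theorem facePerm_apply (d : G.Dart) : R.facePerm d = R.next d.symm := rfl

@[simp] theorem fst_facePerm (d : G.Dart) : (R.facePerm d).fst = d.snd := R.fst_next _

theorem face_next_symm (d : G.Dart) : R.face (R.next d.symm) = R.face d :=
  (R.face_eq_iff.2 (Equiv.Perm.sameCycle_apply_right.2 (Equiv.Perm.SameCycle.refl _ _))).symm

theorem face_next (d : G.Dart) : R.face (R.next d) = R.face d.symm := by
  simpa using R.face_next_symm d.symm

theorem eq_of_sameCycle {X α : Type*} {σ : Equiv.Perm α} {H : α → X} (hH : ∀ a, H (σ a) = H a)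
    {a b : α} (h : σ.SameCycle a b) : H a = H b := by
  obtain ⟨i, rfl⟩ := h
  have hinv : ∀ a, H (σ⁻¹ a) = H a := fun a => by simpa using (hH (σ⁻¹ a)).symm
  induction i with
  | zero => simp
  | succ n ih => rw [add_comm, zpow_add, Equiv.Perm.mul_apply, zpow_one, hH, ← ih]
  | pred n ih => rw [sub_eq_add_neg, add_comm, zpow_add, Equiv.Perm.mul_apply, zpow_neg_one, hinv, ← ih]

/-- A function on faces that does not change across the edges at `v` takes the same value at all
darts leaving `v`. -/
theorem face_const_at {X : Type*} {h : R.FaceWalk → X} {v : V}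
    (hv : ∀ d : G.Dart, d.fst = v → h (R.face d.symm) = h (R.face d))
    {d d' : G.Dart} (hd : d.fst = v) (hd' : d'.fst = v) : h (R.face d) = h (R.face d') := by
  classical
  -- Invariance is required at all darts but known only at `v`; the value `none` makes it trivial
  -- elsewhere.
  have key := eq_of_sameCycle (σ := R.next) (H := fun e => if e.fst = v then some (h (R.face e)) else none)
    (fun e => by
      rw [R.fst_next]
      split_ifs with he
      · rw [R.face_next, hv e he]
      · rfl) (R.sameCycle_next d d' (hd.trans hd'.symm))
  simpa only [hd, hd', if_true, Option.some.injEq] using key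

/-- Rotating around a vertex of the walk and crossing the next edge of the walk both preserve the
value of `h`. -/
theorem face_const_of_walk {X : Type*} {h : R.FaceWalk → X} {B : Set V}
    (hB : ∀ d : G.Dart, d.fst ∈ B → h (R.face d.symm) = h (R.face d)) {u v : V} (w : G.Walk u v)
    (hw : ∀ x ∈ w.support, x ∈ B) {d d' : G.Dart} (hd : d.fst = u) (hd' : d'.fst = v) :
    h (R.face d) = h (R.face d') := by
  induction w generalizing d with
  | @nil a =>
    have hu : a ∈ B := hw _ (by simp)
    exact R.face_const_at (fun e he => hB e (by rwa [he])) hd hd'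
  | @cons a b c hab p ih =>
    have ha : a ∈ B := hw _ (by simp)
    rw [R.face_const_at (d' := ⟨(a, b), hab⟩) (fun e he => hB e (by rwa [he])) hd rfl,
      ← hB ⟨(a, b), hab⟩ ha]
    exact ih (fun x hx => hw x (by simp [hx])) rfl hd'

theorem face_const_of_reachable {X : Type*} {h : R.FaceWalk → X} {B : Set V}
    (hB : ∀ d : G.Dart, d.fst ∈ B → h (R.face d.symm) = h (R.face d))
    (hc : (G.induce B).Preconnected) {d d' : G.Dart} (hd : d.fst ∈ B) (hd' : d'.fst ∈ B) :
    h (R.face d) = h (R.face d') := by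
  obtain ⟨w⟩ := hc ⟨_, hd⟩ ⟨_, hd'⟩
  refine R.face_const_of_walk hB (w.map (Embedding.induce B).toHom) ?_ rfl rfl
  intro x hx
  rw [Walk.support_map, List.mem_map] at hx
  obtain ⟨y, -, rfl⟩ := hx
  exact y.2

/-- The sum of the coboundary of a function on faces and the coboundary of a function on
vertices, as a function on darts. -/
def coboundarySum : ((R.FaceWalk → ℚ) × (V → ℚ)) →ₗ[ℚ] (G.Dart → ℚ) where
  toFun x d := (x.1 (R.face d) - x.1 (R.face d.symm)) + (x.2 d.snd - x.2 d.fst)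
  map_add' x y := by ext d; simp; ring
  map_smul' c x := by ext d; simp; ring

theorem coboundarySum_symm (x) (d : G.Dart) :
    R.coboundarySum x d.symm = - R.coboundarySum x d := by
  simp [coboundarySum]; ring

instance [Finite V] : Finite G.Dart :=
  Finite.of_injective Dart.toProd Dart.toProd_injective

instance [Finite V] : Finite R.FaceWalk := Quotient.finite _

theorem exists_dart_edge_eq (e : G.edgeSet) : ∃ d : G.Dart, d.edge = e := by
  obtain ⟨⟨u, v⟩, h⟩ := e
  exact ⟨⟨(u, v), h⟩, rfl⟩

theorem card_component_add_isolated_le [Finite V] :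
    Nat.card {c : G.ConnectedComponent // ∃ d : G.Dart, G.connectedComponentMk d.fst = c} +
      {v : V | G.IsIsolated v}.ncard ≤ Nat.card G.ConnectedComponent := by
  classical
  rw [← Nat.card_coe_set_eq, ← Nat.card_sum]
  refine Nat.card_le_card_of_injective
    (Sum.elim Subtype.val fun v => G.connectedComponentMk v.1) ?_
  have hiso : ∀ {u v : V}, G.IsIsolated u → G.Reachable u v → u = v := by
    rintro u v hu ⟨w⟩
    cases w with
    | nil => rfl
    | cons h p => exact absurd h (hu _)
  rintro (⟨c, d, rfl⟩ | ⟨u, hu⟩) (⟨c', d', rfl⟩ | ⟨v, hv⟩) h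
  · simpa using h
  · have := hiso hv (ConnectedComponent.exact h.symm)
    exact absurd d.adj (by rw [← this]; exact hv _)
  · have := hiso hu (ConnectedComponent.exact h)
    exact absurd d'.adj (by rw [← this]; exact hu _)
  · simpa using hiso hu (ConnectedComponent.exact h)

/-- Face coboundaries are orthogonal to vertex coboundaries: the net change of `g` along a closed
face walk is zero. -/
theorem sum_face_coboundary_mul [Fintype V] [DecidableRel G.Adj]
    (h : R.FaceWalk → ℚ) (g : V → ℚ) :
    ∑ d : G.Dart, (h (R.face d) - h (R.face d.symm)) * (g d.snd - g d.fst) = 0 := by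
  have h1 : ∑ d : G.Dart, h (R.face d.symm) * (g d.snd - g d.fst) =
      ∑ d : G.Dart, h (R.face d) * (g d.fst - g d.snd) :=
    Fintype.sum_equiv (Function.Involutive.toPerm Dart.symm Dart.symm_involutive) _ _
      (fun d => by simp)
  have h2 : ∑ d : G.Dart, h (R.face d) * g d.snd = ∑ d : G.Dart, h (R.face d) * g d.fst :=
    Fintype.sum_equiv R.facePerm _ _ (fun d => by
      rw [R.fst_facePerm, R.facePerm_apply, R.face_next_symm])
  simp only [sub_mul, Finset.sum_sub_distrib, mul_sub] at h1 h2 ⊢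
  linarith

/-- By orthogonality each summand has norm zero, so positivity of squares over `ℚ` makes both
vanish. -/
theorem of_coboundarySum_eq_zero [Fintype V] [DecidableRel G.Adj]
    {h : R.FaceWalk → ℚ} {g : V → ℚ}
    (hx : R.coboundarySum (h, g) = 0) :
    (∀ d : G.Dart, h (R.face d.symm) = h (R.face d)) ∧ ∀ d : G.Dart, g d.snd = g d.fst := by
  have h0 : ∀ d : G.Dart, (h (R.face d) - h (R.face d.symm)) + (g d.snd - g d.fst) = 0 :=
    fun d => congrFun hx d
  have hs : ∑ d : G.Dart, (g d.snd - g d.fst) * (g d.snd - g d.fst) = 0 := by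
    rw [← neg_eq_zero, ← R.sum_face_coboundary_mul h g, ← Finset.sum_neg_distrib]
    refine Finset.sum_congr rfl fun d _ => ?_
    rw [eq_neg_of_add_eq_zero_left (h0 d)]; ring
  rw [Finset.sum_eq_zero_iff_of_nonneg (fun d _ => mul_self_nonneg _)] at hs
  have hg : ∀ d : G.Dart, g d.snd - g d.fst = 0 := fun d => mul_self_eq_zero.1 (hs d (mem_univ d))
  exact ⟨fun d => by linarith [h0 d, hg d], fun d => by linarith [hg d]⟩

/-- The sum of two coboundaries, evaluated on one dart of each edge. -/
noncomputable def edgeCoboundary : ((R.FaceWalk → ℚ) × (V → ℚ)) →ₗ[ℚ] (G.edgeSet → ℚ) :=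
  LinearMap.funLeft ℚ ℚ (fun e => (exists_dart_edge_eq e).choose) ∘ₗ R.coboundarySum

theorem eq_of_edgeCoboundary {x : (R.FaceWalk → ℚ) × (V → ℚ)} {f : G.Dart → ℚ}
    (hf : ∀ d, f d.symm = - f d)
    (h : R.edgeCoboundary x = fun e => f (exists_dart_edge_eq e).choose) :
    R.coboundarySum x = f := by
  ext d
  have h1 := congrFun h ⟨d.edge, d.edge_mem⟩
  have h2 := (exists_dart_edge_eq ⟨d.edge, d.edge_mem⟩).choose_spec
  simp only [edgeCoboundary, LinearMap.comp_apply, LinearMap.funLeft_apply] at h1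
  rcases (dart_edge_eq_iff _ _).1 h2 with h3 | h3
  · rwa [h3] at h1
  · rw [h3, coboundarySum_symm, hf] at h1
    exact neg_injective h1

section Finite

variable [Fintype V] [DecidableRel G.Adj]

theorem sum_circulation_mul [DecidableEq V] {f : G.Dart → ℚ} (hf : ∀ d, f d.symm = - f d)
    (hc : ∀ v, ∑ d : G.Dart with d.fst = v, f d = 0) (g : V → ℚ) :
    ∑ d : G.Dart, f d * (g d.snd - g d.fst) = 0 := by
  classical
  have h1 : ∑ d : G.Dart, f d * g d.fst = 0 := by
    rw [← Finset.sum_fiberwise_of_maps_to (t := univ) (g := fun d : G.Dart => d.fst) (by simp)]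
    refine Finset.sum_eq_zero fun v _ => ?_
    rw [← zero_mul (g v), ← hc v, Finset.sum_mul]
    refine Finset.sum_congr rfl fun d hd => ?_
    rw [(Finset.mem_filter.1 hd).2]
  have h2 : ∑ d : G.Dart, f d * g d.snd = ∑ d : G.Dart, - (f d * g d.fst) :=
    Fintype.sum_equiv (Function.Involutive.toPerm Dart.symm Dart.symm_involutive) _ _
      (fun d => by simp [hf])
  rw [Finset.sum_neg_distrib, h1] at h2
  simp only [mul_sub, Finset.sum_sub_distrib, h1, h2]
  simp

/-- In the kernel both coboundaries vanish, so `g` is constant on each component and `h` is constant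
on the faces of each component that has an edge. Values at representatives determine the pair. -/
theorem finrank_ker_edgeCoboundary_le :
    Module.finrank ℚ (LinearMap.ker R.edgeCoboundary) ≤
      Nat.card {c : G.ConnectedComponent // ∃ d : G.Dart, G.connectedComponentMk d.fst = c} +
        Nat.card G.ConnectedComponent := by
  classical
  set N := {c : G.ConnectedComponent // ∃ d : G.Dart, G.connectedComponentMk d.fst = c}
  let T : ((R.FaceWalk → ℚ) × (V → ℚ)) →ₗ[ℚ] ((N → ℚ) × (G.ConnectedComponent → ℚ)) :=
    LinearMap.prodMap (LinearMap.funLeft ℚ ℚ fun c => R.face c.2.choose)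
      (LinearMap.funLeft ℚ ℚ fun c => Quot.out c)
  have hinj : Function.Injective (T ∘ₗ (LinearMap.ker R.edgeCoboundary).subtype) := by
    rw [← LinearMap.ker_eq_bot, LinearMap.ker_eq_bot']
    rintro ⟨⟨h, g⟩, hx⟩ h0
    have hx' : R.coboundarySum (h, g) = 0 :=
      R.eq_of_edgeCoboundary (f := 0) (by simp) (by rw [LinearMap.mem_ker.1 hx]; rfl)
    obtain ⟨hh, hg⟩ := R.of_coboundarySum_eq_zero hx'
    have h1 : ∀ c : N, h (R.face c.2.choose) = 0 := fun c => congrFun (congrArg Prod.fst h0) c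
    have h2 : ∀ c : G.ConnectedComponent, g (Quot.out c) = 0 :=
      fun c => congrFun (congrArg Prod.snd h0) c
    have hg' : ∀ {u v}, G.Reachable u v → g u = g v := by
      rintro u v ⟨w⟩
      induction w with
      | nil => rfl
      | cons hab p ih => rw [← ih]; exact (hg ⟨(_, _), hab⟩).symm
    have e1 : h = 0 := by
      ext x
      obtain ⟨d, rfl⟩ := R.face_surjective x
      let c : N := ⟨G.connectedComponentMk d.fst, d, rfl⟩
      obtain ⟨w⟩ := ConnectedComponent.exact c.2.choose_spec
      rw [← R.face_const_of_walk (B := Set.univ) (fun d _ => hh d) w (by simp)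
        rfl rfl, h1 c]
      rfl
    have e2 : g = 0 := by
      ext v
      have hr : G.Reachable (Quot.out (G.connectedComponentMk v)) v :=
        ConnectedComponent.exact (Quot.out_eq (G.connectedComponentMk v))
      rw [← hg' hr, h2]
      rfl
    exact Subtype.ext (Prod.ext e1 e2)
  have := Fintype.ofFinite N
  have := Fintype.ofFinite G.ConnectedComponent
  have := Fintype.ofFinite R.FaceWalk
  have := LinearMap.finrank_le_finrank_of_injective hinj
  rwa [Module.finrank_prod, Module.finrank_fintype_fun_eq_card,
    Module.finrank_fintype_fun_eq_card, ← Nat.card_eq_fintype_card,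
    ← Nat.card_eq_fintype_card] at this

theorem card_add_card_le_finrank_range :
    Nat.card V + (Nat.card R.FaceWalk + {v : V | G.IsIsolated v}.ncard) ≤
      Module.finrank ℚ (LinearMap.range R.edgeCoboundary) + 2 * Nat.card G.ConnectedComponent := by
  classical
  have := Fintype.ofFinite R.FaceWalk
  have h1 := LinearMap.finrank_range_add_finrank_ker R.edgeCoboundary
  rw [Module.finrank_prod, Module.finrank_fintype_fun_eq_card,
    Module.finrank_fintype_fun_eq_card, ← Nat.card_eq_fintype_card,
    ← Nat.card_eq_fintype_card] at h1
  have h2 := R.finrank_ker_edgeCoboundary_le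
  have h3 := card_component_add_isolated_le (G := G)
  omega

/-- The Euler characteristic of an embedding is at most that of a sphere for every component. -/
theorem euler_le :
    Nat.card V + (Nat.card R.FaceWalk + {v : V | G.IsIsolated v}.ncard) ≤
      G.edgeSet.ncard + 2 * Nat.card G.ConnectedComponent := by
  refine R.card_add_card_le_finrank_range.trans (Nat.add_le_add_right ?_ _)
  refine (Submodule.finrank_le _).trans_eq ?_
  rw [Module.finrank_fintype_fun_eq_card, ← Nat.card_eq_fintype_card, Nat.card_coe_set_eq]

/-- In the sphere, every circulation is a coboundary of a function on faces. -/
theorem IsPlanar.exists_face_potential [DecidableEq V] {R : G.RotationSystem} (hR : R.IsPlanar)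
    {f : G.Dart → ℚ} (hf : ∀ d, f d.symm = - f d)
    (hc : ∀ v, ∑ d : G.Dart with d.fst = v, f d = 0) :
    ∃ h : R.FaceWalk → ℚ, ∀ d, f d = h (R.face d) - h (R.face d.symm) := by
  -- Genus zero turns the lower bound for the rank into the number of edges, so every antisymmetric
  -- dart function is a sum of the two kinds of coboundary.
  have hr : LinearMap.range R.edgeCoboundary = ⊤ := by
    refine Submodule.eq_top_of_finrank_eq (le_antisymm (Submodule.finrank_le _) ?_)
    have := R.card_add_card_le_finrank_range
    rw [hR] at this
    rw [Module.finrank_fintype_fun_eq_card, ← Nat.card_eq_fintype_card, Nat.card_coe_set_eq]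
    omega
  obtain ⟨⟨h, g⟩, hx⟩ := LinearMap.range_eq_top.1 hr
    (fun e => f (exists_dart_edge_eq e).choose)
  have hfd : ∀ d, f d = (h (R.face d) - h (R.face d.symm)) + (g d.snd - g d.fst) :=
    fun d => (congrFun (R.eq_of_edgeCoboundary hf hx) d).symm
  have h1 := sum_circulation_mul hf hc g
  have h2 := R.sum_face_coboundary_mul h g
  -- The circulation and its face part are both orthogonal to the vertex part, which is therefore
  -- orthogonal to itself.
  have h3 : ∑ d : G.Dart, (g d.snd - g d.fst) * (g d.snd - g d.fst) = 0 := by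
    simp only [hfd, add_mul, Finset.sum_add_distrib] at h1
    linarith
  rw [Finset.sum_eq_zero_iff_of_nonneg (fun d _ => mul_self_nonneg _)] at h3
  refine ⟨h, fun d => ?_⟩
  rw [hfd d, mul_self_eq_zero.1 (h3 d (mem_univ d)), add_zero]

end Finite
end SimpleGraph.RotationSystem

/-! ### Inserting a chord into a face -/

namespace SimpleGraph.RotationSystem

open Finset

section Arc

variable {α : Type*} (φ : Equiv.Perm α) (p q : α)

/-- The arc of a cycle of `φ` that starts at `p` and ends before `q`. -/
def InArc (d : α) : Prop := ∃ i : ℕ, φ^[i] p = d ∧ ∀ j ≤ i, φ^[j] p ≠ q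

variable {φ p q}

theorem inArc_apply_iff {d : α} (hp : φ d ≠ p) (hq : φ d ≠ q) :
    InArc φ p q (φ d) ↔ InArc φ p q d := by
  constructor
  · rintro ⟨i, hi, hj⟩
    cases i with
    | zero => exact absurd hi.symm hp
    | succ i =>
      rw [Function.iterate_succ_apply'] at hi
      exact ⟨i, φ.injective hi, fun j hji => hj j (by omega)⟩
  · rintro ⟨i, hi, hj⟩
    refine ⟨i + 1, by rw [Function.iterate_succ_apply', hi], fun j hji => ?_⟩
    rcases Nat.lt_or_ge i j with h | h
    · obtain rfl : j = i + 1 := by omega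
      rwa [Function.iterate_succ_apply', hi]
    · exact hj j h

theorem not_inArc_right : ¬ InArc φ p q q := fun ⟨i, hi, hj⟩ => hj i le_rfl hi

theorem inArc_left (h : p ≠ q) : InArc φ p q p :=
  ⟨0, rfl, fun j hj => by obtain rfl : j = 0 := by omega
                          exact h⟩

variable [Finite α]

theorem exists_iterate_eq (h : φ.SameCycle p q) : ∃ n : ℕ, φ^[n] p = q := by
  obtain ⟨n, hn⟩ := h.exists_nat_pow_eq
  exact ⟨n, by rw [← Equiv.Perm.coe_pow, hn]⟩

theorem inArc_of_apply_eq_right {d : α} (hpq : p ≠ q) (h : φ.SameCycle p q) (hd : φ d = q) :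
    InArc φ p q d := by
  classical
  have hex := exists_iterate_eq h
  obtain ⟨k, hk⟩ : ∃ k, Nat.find hex = k + 1 := by
    refine Nat.exists_eq_succ_of_ne_zero fun h0 => hpq ?_
    have := Nat.find_spec hex
    rwa [h0] at this
  refine ⟨k, φ.injective ?_, fun j hj => Nat.find_min hex (by omega)⟩
  rw [hd, ← Function.iterate_succ_apply' φ, ← Nat.find_spec hex, hk]

/-- An arc reaching the predecessor of `p` would have run through the whole cycle without meeting
`q`. -/
theorem not_inArc_of_apply_eq_left {d : α} (h : φ.SameCycle p q) (hd : φ d = p) :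
    ¬ InArc φ p q d := by
  rintro ⟨i, hi, hj⟩
  obtain ⟨n, hn⟩ := exists_iterate_eq h
  have hper : Function.IsPeriodicPt φ (i + 1) p := by
    rw [Function.IsPeriodicPt, Function.IsFixedPt, Function.iterate_succ_apply', hi, hd]
  refine hj (n % (i + 1)) (Nat.lt_succ_iff.1 (Nat.mod_lt _ (Nat.succ_pos i))) ?_
  rw [hper.iterate_mod_apply, hn]

end Arc

variable {V : Type*} {G : SimpleGraph V} (R : G.RotationSystem) (p q : G.Dart)

section ChordPerm

open Classical in
/-- The rotation around the vertices after a chord has been inserted before the darts `p` and `q`: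
the darts of the chord are `inr true`, which leaves the initial vertex of `p`, and its reverse
`inr false`. -/
noncomputable def chordNext (hpq : p ≠ q) : Equiv.Perm (G.Dart ⊕ Bool) where
  toFun
    | .inl d => if R.next d = p then .inr true else if R.next d = q then .inr false
        else .inl (R.next d)
    | .inr true => .inl p
    | .inr false => .inl q
  invFun
    | .inl d => if d = p then .inr true else if d = q then .inr false else .inl (R.next.symm d)
    | .inr true => .inl (R.next.symm p)
    | .inr false => .inl (R.next.symm q)
  left_inv := by
    rintro (d | (_ | _))
    · by_cases h1 : R.next d = p
      · simp [← h1]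
      · by_cases h2 : R.next d = q
        · simp [h1, ← h2]
        · simp [h1, h2]
    · simp [hpq.symm]
    · simp
  right_inv := by
    rintro (d | (_ | _))
    · by_cases h1 : d = p
      · simp [← h1]
      · by_cases h2 : d = q
        · simp [h1, ← h2]
        · simp [h1, h2]
    · simp [hpq.symm]
    · simp

/-- The dart of the graph with the chord. -/
def chordDart (hne : p.fst ≠ q.fst) : G.Dart ⊕ Bool → (G ⊔ edge p.fst q.fst).Dart
  | .inl d => ⟨d.toProd, Or.inl d.adj⟩
  | .inr true => ⟨(p.fst, q.fst), Or.inr ((edge_adj _ _ _ _).2 ⟨Or.inl ⟨rfl, rfl⟩, hne⟩)⟩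
  | .inr false => ⟨(q.fst, p.fst), Or.inr ((edge_adj _ _ _ _).2 ⟨Or.inr ⟨rfl, rfl⟩, hne.symm⟩)⟩

theorem chordDart_bijective (hne : p.fst ≠ q.fst) (hadj : ¬ G.Adj p.fst q.fst) :
    Function.Bijective (chordDart p q hne) := by
  constructor
  · have aux : ∀ d : G.Dart, d.toProd ≠ (p.fst, q.fst) := fun d h => by
      have := d.adj
      rw [h] at this
      exact hadj this
    have aux' : ∀ d : G.Dart, d.toProd ≠ (q.fst, p.fst) := fun d h => by
      have := d.adj
      rw [h] at this
      exact hadj this.symm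
    rintro (d | (_ | _)) (d' | (_ | _)) h
    all_goals have h' := congrArg Dart.toProd h
    all_goals simp only [chordDart] at h'
    · rw [Dart.ext _ _ h']
    · exact absurd h' (aux' _)
    · exact absurd h' (aux _)
    · exact absurd h'.symm (aux' _)
    · rfl
    · exact absurd (congrArg Prod.fst h').symm hne
    · exact absurd h'.symm (aux _)
    · exact absurd (congrArg Prod.fst h') hne
    · rfl
  · rintro ⟨⟨a, b⟩, h | h⟩
    · exact ⟨.inl ⟨(a, b), h⟩, rfl⟩
    · obtain ⟨⟨h1, h2⟩ | ⟨h1, h2⟩, -⟩ := (edge_adj _ _ _ _).1 h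
      · exact ⟨.inr true, Dart.ext _ _ (Prod.ext h1.symm h2.symm)⟩
      · exact ⟨.inr false, Dart.ext _ _ (Prod.ext h1.symm h2.symm)⟩


theorem sameCycle_of_semiconj {α β : Type*} {σ : Equiv.Perm α} {τ : Equiv.Perm β} {g : α → β}
    (h : ∀ a, τ.SameCycle (g a) (g (σ a))) {a b : α} (hab : σ.SameCycle a b) :
    τ.SameCycle (g a) (g b) :=
  Quotient.exact (s := Equiv.Perm.SameCycle.setoid τ) <|
    eq_of_sameCycle (H := fun a => Quotient.mk (Equiv.Perm.SameCycle.setoid τ) (g a))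
      (fun a => Quotient.sound (h a).symm) hab

theorem sameCycle_chordNext (hpq : p ≠ q) (d : G.Dart) :
    (R.chordNext p q hpq).SameCycle (.inl d) (.inl (R.next d)) := by
  have h1 : ∀ x, (R.chordNext p q hpq).SameCycle x (R.chordNext p q hpq x) :=
    fun x => Equiv.Perm.sameCycle_apply_right.2 (Equiv.Perm.SameCycle.refl _ _)
  refine (h1 _).trans ?_
  by_cases hp : R.next d = p
  · rw [hp, show R.chordNext p q hpq (.inl d) = .inr true by simp [chordNext, hp]]
    exact h1 (.inr true)
  · by_cases hq : R.next d = q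
    · rw [hq, show R.chordNext p q hpq (.inl d) = .inr false by
      simp [chordNext, hq, hpq.symm]]
      exact h1 (.inr false)
    · rw [show R.chordNext p q hpq (.inl d) = .inl (R.next d) by simp [chordNext, hp, hq]]

theorem ne_of_fst_ne {p q : G.Dart} (h : p.fst ≠ q.fst) : p ≠ q := fun e => h (by rw [e])

variable (hne : p.fst ≠ q.fst) (hadj : ¬ G.Adj p.fst q.fst)

/-- The darts of the graph with the chord. -/
noncomputable def chordDartEquiv : G.Dart ⊕ Bool ≃ (G ⊔ edge p.fst q.fst).Dart :=
  Equiv.ofBijective _ (chordDart_bijective p q hne hadj)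

/-- The rotation system after the chord has been inserted before the darts `p` and `q`. -/
noncomputable def addChord : (G ⊔ edge p.fst q.fst).RotationSystem where
  next := ((chordDartEquiv p q hne hadj).symm.trans (R.chordNext p q (ne_of_fst_ne hne))).trans
    (chordDartEquiv p q hne hadj)
  fst_next d := by
    obtain ⟨x, rfl⟩ := (chordDartEquiv p q hne hadj).surjective d
    simp only [Equiv.trans_apply, Equiv.symm_apply_apply]
    rcases x with d | _ | _
    · have hd := R.fst_next d
      by_cases hp : R.next d = p
      · rw [show R.chordNext p q (ne_of_fst_ne hne) (.inl d) = .inr true by simp [chordNext, hp]]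
        rwa [hp] at hd
      · by_cases hq : R.next d = q
        · rw [show R.chordNext p q (ne_of_fst_ne hne) (.inl d) = .inr false by
            simp [chordNext, hq, (ne_of_fst_ne hne).symm]]
          rwa [hq] at hd
        · rwa [show R.chordNext p q (ne_of_fst_ne hne) (.inl d) = .inl (R.next d) by
            simp [chordNext, hp, hq]]
    · rfl
    · rfl
  sameCycle_next d d' h := by
    obtain ⟨x, rfl⟩ := (chordDartEquiv p q hne hadj).surjective d
    obtain ⟨y, rfl⟩ := (chordDartEquiv p q hne hadj).surjective d'
    refine sameCycle_of_semiconj (σ := R.chordNext p q (ne_of_fst_ne hne)) (fun a => ?_) ?_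
    · rw [← Equiv.Perm.sameCycle_apply_left]
      simp only [Equiv.trans_apply, Equiv.symm_apply_apply]
      exact Equiv.Perm.SameCycle.refl _ _
    -- Each chord dart is followed by `p` or `q` in the rotation, so every dart can be exchanged for
    -- an old one at the same vertex.
    · have key : ∀ x, ∃ d : G.Dart, d.fst = (chordDartEquiv p q hne hadj x).fst ∧
          (R.chordNext p q (ne_of_fst_ne hne)).SameCycle x (.inl d) := by
        rintro (d | _ | _)
        · exact ⟨d, rfl, Equiv.Perm.SameCycle.refl _ _⟩
        · exact ⟨q, rfl, Equiv.Perm.sameCycle_apply_right.2 (Equiv.Perm.SameCycle.refl _ _)⟩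
        · exact ⟨p, rfl, Equiv.Perm.sameCycle_apply_right.2 (Equiv.Perm.SameCycle.refl _ _)⟩
      obtain ⟨d, hd, hxd⟩ := key x
      obtain ⟨d', hd', hyd⟩ := key y
      exact (hxd.trans (sameCycle_of_semiconj (R.sameCycle_chordNext p q _)
        (R.sameCycle_next d d' (by rw [hd, hd', h])))).trans hyd.symm

theorem facePerm_addChord_inl (d : G.Dart) :
    (R.addChord p q hne hadj).facePerm (chordDartEquiv p q hne hadj (.inl d)) =
      chordDartEquiv p q hne hadj (R.chordNext p q (ne_of_fst_ne hne) (.inl d.symm)) := by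
  rw [facePerm_apply, show (chordDartEquiv p q hne hadj (.inl d)).symm =
    chordDartEquiv p q hne hadj (.inl d.symm) from rfl]
  simp [addChord]

theorem facePerm_addChord_true :
    (R.addChord p q hne hadj).facePerm (chordDartEquiv p q hne hadj (.inr true)) =
      chordDartEquiv p q hne hadj (.inl q) := by
  rw [facePerm_apply, show (chordDartEquiv p q hne hadj (.inr true)).symm =
    chordDartEquiv p q hne hadj (.inr false) from rfl]
  simp [addChord, chordNext]

theorem facePerm_addChord_false :
    (R.addChord p q hne hadj).facePerm (chordDartEquiv p q hne hadj (.inr false)) =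
      chordDartEquiv p q hne hadj (.inl p) := by
  rw [facePerm_apply, show (chordDartEquiv p q hne hadj (.inr false)).symm =
    chordDartEquiv p q hne hadj (.inr true) from rfl]
  simp [addChord, chordNext]

open Classical in
/-- The face that is split by the chord gives a face of the old embedding and one new face. -/
noncomputable def chordFace : G.Dart ⊕ Bool → Option R.FaceWalk
  | .inl d => if R.face d = R.face p ∧ ¬ InArc R.facePerm p q d then none else some (R.face d)
  | .inr true => none
  | .inr false => some (R.face p)

end ChordPerm

section Finite

variable [Finite V] {p q} (hne : p.fst ≠ q.fst) (hadj : ¬ G.Adj p.fst q.fst)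

/-- The chord closes the arc from `p` to `q` by `inr false` and the rest of the old face by `inr
true`. Thus the label is constant on new face walks, which is what lets it count them. -/
theorem chordFace_facePerm (hf : R.face p = R.face q) (x : G.Dart ⊕ Bool) :
    R.chordFace p q ((chordDartEquiv p q hne hadj).symm
      ((R.addChord p q hne hadj).facePerm (chordDartEquiv p q hne hadj x))) =
      R.chordFace p q x := by
  have hpq := ne_of_fst_ne hne
  have hs := R.face_eq_iff.1 hf
  rcases x with d | _ | _
  · rw [facePerm_addChord_inl, Equiv.symm_apply_apply]
    have hd : R.face d = R.face (R.facePerm d) := (R.face_next_symm d).symm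
    by_cases hp : R.facePerm d = p
    · have hp' : R.next d.symm = p := hp
      rw [show R.chordNext p q hpq (.inl d.symm) = .inr true by simp [chordNext, hp']]
      simp [chordFace, hd, hp, not_inArc_of_apply_eq_left hs hp]
    · have hp' : R.next d.symm ≠ p := hp
      by_cases hq : R.facePerm d = q
      · have hq' : R.next d.symm = q := hq
        rw [show R.chordNext p q hpq (.inl d.symm) = .inr false by simp [chordNext, hq', hpq.symm]]
        simp [chordFace, hd, hq, inArc_of_apply_eq_right hpq hs hq, hf]
      · have hq' : R.next d.symm ≠ q := hq
        rw [show R.chordNext p q hpq (.inl d.symm) = .inl (R.facePerm d) by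
          simp [chordNext, hq', hp']]
        simp only [chordFace]
        rw [← hd, inArc_apply_iff hp hq]
  · rw [facePerm_addChord_false, Equiv.symm_apply_apply]
    simp [chordFace, inArc_left hpq]
  · rw [facePerm_addChord_true, Equiv.symm_apply_apply]
    simp [chordFace, not_inArc_right, hf]

theorem card_faceWalk_addChord (hf : R.face p = R.face q) :
    Nat.card R.FaceWalk + 1 ≤ Nat.card (R.addChord p q hne hadj).FaceWalk := by
  rw [← Finite.card_option]
  let e := chordDartEquiv p q hne hadj
  let κ : (R.addChord p q hne hadj).FaceWalk → Option R.FaceWalk :=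
    Quotient.lift (fun d => R.chordFace p q (e.symm d)) fun a b h => by
      refine eq_of_sameCycle (σ := (R.addChord p q hne hadj).facePerm)
        (H := fun d => R.chordFace p q (e.symm d)) (fun a => ?_) h
      obtain ⟨x, rfl⟩ := e.surjective a
      rw [R.chordFace_facePerm hne hadj hf, Equiv.symm_apply_apply]
  have hκ : ∀ x, κ ((R.addChord p q hne hadj).face (e x)) = R.chordFace p q x := fun x => by
    change R.chordFace p q (e.symm (e x)) = _
    rw [Equiv.symm_apply_apply]
  refine Nat.card_le_card_of_surjective κ ?_
  rintro (_ | f)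
  · exact ⟨_, hκ (.inr true)⟩
  · by_cases h : f = R.face p
    · exact ⟨_, (hκ (.inr false)).trans (by rw [h]; rfl)⟩
    · obtain ⟨d, rfl⟩ := R.face_surjective f
      exact ⟨_, (hκ (.inl d)).trans (by simp [chordFace, h])⟩

end Finite

section Maximal

variable [Fintype V] [DecidableEq V] [DecidableRel G.Adj]

/-- A chord of a face can be added to a plane graph. -/
theorem IsPlanar.addChord {R : G.RotationSystem} (hR : R.IsPlanar) {p q : G.Dart}
    (hne : p.fst ≠ q.fst) (hadj : ¬ G.Adj p.fst q.fst) (hf : R.face p = R.face q) :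
    (R.addChord p q hne hadj).IsPlanar := by
  classical
  have h1 := (R.addChord p q hne hadj).euler_le
  have h2 := R.card_faceWalk_addChord hne hadj hf
  have h3 : {v : V | G.IsIsolated v}.ncard ≤
      {v : V | (G ⊔ edge p.fst q.fst).IsIsolated v}.ncard := by
    refine Set.ncard_le_ncard (fun v hv w hw => ?_) (Set.toFinite _)
    rcases hw with hw | hw
    · exact hv w hw
    · obtain ⟨⟨rfl, -⟩ | ⟨rfl, -⟩, -⟩ := (edge_adj _ _ _ _).1 hw
      · exact hv _ p.adj
      · exact hv _ q.adj
  have h4 : (G ⊔ edge p.fst q.fst).edgeSet.ncard ≤ G.edgeSet.ncard + 1 := by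
    rw [edgeSet_sup]
    refine (Set.ncard_union_le _ _).trans (Nat.add_le_add_left ?_ _)
    refine (Set.ncard_le_ncard (t := {s(p.fst, q.fst)}) ?_).trans (Set.ncard_singleton _).le
    simp [edge]
  have h5 : Nat.card (G ⊔ edge p.fst q.fst).ConnectedComponent ≤
      Nat.card G.ConnectedComponent :=
    Nat.card_le_card_of_surjective
      (ConnectedComponent.map (Hom.ofLE (le_sup_left : G ≤ G ⊔ edge p.fst q.fst))) fun c => by
        induction c using ConnectedComponent.ind with
        | h v => exact ⟨G.connectedComponentMk v, rfl⟩
  unfold IsPlanar at hR ⊢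
  -- The chord adds at least one face and at most one edge, and it creates no component and destroys
  -- no isolated vertex. So the Euler equality for `G` gives the inequality opposite to `euler_le`.
  omega

end Maximal

end SimpleGraph.RotationSystem

open SimpleGraph RotationSystem in
/-- Two vertices on a face of a maximal planar graph are equal or adjacent. -/
theorem SimpleGraph.IsMaximalPlanar.adj_of_face_eq {V : Type*} [Fintype V] {G : SimpleGraph V}
    (hG : G.IsMaximalPlanar) {R : G.RotationSystem} (hR : R.IsPlanar) {p q : G.Dart}
    (hf : R.face p = R.face q) (hne : p.fst ≠ q.fst) : G.Adj p.fst q.fst := by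
  classical
  by_contra hadj
  exact hG.2 _ (G.lt_sup_edge _ _ hne hadj) ⟨_, hR.addChord hne hadj hf⟩

/-! ### Flows along walks and triangular faces -/

namespace SimpleGraph

open Finset

variable {V : Type*} {G : SimpleGraph V}

theorem Dart.ext_fst_snd {d e : G.Dart} (h1 : d.fst = e.fst) (h2 : d.snd = e.snd) : d = e :=
  Dart.ext _ _ (Prod.ext h1 h2)

section Flow

variable [DecidableEq V]

/-- The unit flow along a dart. -/
def unitFlow (a e : G.Dart) : ℚ := (if e = a then 1 else 0) - (if e = a.symm then 1 else 0)

theorem unitFlow_symm (a e : G.Dart) : unitFlow a e.symm = - unitFlow a e := by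
  have h1 : e.symm = a ↔ e = a.symm :=
    ⟨fun h => by rw [← h, Dart.symm_symm], fun h => by rw [h, Dart.symm_symm]⟩
  have h2 : e.symm = a.symm ↔ e = a := Dart.symm_involutive.injective.eq_iff
  simp [unitFlow, h1, h2]

theorem unitFlow_eq_zero {a e : G.Dart} (h1 : e.fst ≠ a.fst) (h2 : e.fst ≠ a.snd) :
    unitFlow a e = 0 := by
  have h3 : e ≠ a := fun h => h1 (by rw [h])
  have h4 : e ≠ a.symm := fun h => h2 (by rw [h]; rfl)
  simp [unitFlow, h3, h4]

/-- The flow along a walk. -/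
def Walk.flow {u v : V} (w : G.Walk u v) (e : G.Dart) : ℚ :=
  (w.darts.map fun a => unitFlow a e).sum

theorem Walk.flow_symm {u v : V} (w : G.Walk u v) (e : G.Dart) :
    w.flow e.symm = - w.flow e := by
  simp only [Walk.flow, unitFlow_symm]
  induction w.darts with
  | nil => simp
  | cons a l ih => simp [ih]; ring

theorem Walk.flow_cons {u v w : V} (h : G.Adj u v) (p : G.Walk v w) (e : G.Dart) :
    (Walk.cons h p).flow e = unitFlow ⟨(u, v), h⟩ e + p.flow e := by
  simp [Walk.flow]

@[simp] theorem Walk.flow_nil {u : V} (e : G.Dart) : (Walk.nil : G.Walk u u).flow e = 0 := rfl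

theorem Walk.flow_eq_zero {u v : V} (w : G.Walk u v) {e : G.Dart} (he : e.fst ∉ w.support) :
    w.flow e = 0 := by
  induction w with
  | nil => rfl
  | cons h p ih =>
    rw [Walk.support_cons, List.mem_cons, not_or] at he
    rw [Walk.flow_cons, ih he.2, unitFlow_eq_zero he.1, add_zero]
    rintro h
    exact he.2 (by rw [h]; exact p.start_mem_support)

theorem Walk.flow_eq_zero_of_notMem_edges {u v : V} (w : G.Walk u v) {e : G.Dart}
    (he : e.edge ∉ w.edges) : w.flow e = 0 := by
  induction w with
  | nil => rfl
  | cons h p ih =>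
    rw [Walk.edges_cons, List.mem_cons, not_or] at he
    have h1 : e ≠ ⟨(_, _), h⟩ := fun h' => he.1 (by rw [h']; rfl)
    have h2 : e ≠ Dart.symm ⟨(_, _), h⟩ := fun h' => he.1 (by rw [h', Dart.edge_symm]; rfl)
    rw [Walk.flow_cons, ih he.2, unitFlow, if_neg h1, if_neg h2]
    norm_num

variable [Fintype V] [DecidableRel G.Adj]

theorem sum_unitFlow (a : G.Dart) (v : V) :
    ∑ e : G.Dart with e.fst = v, unitFlow a e =
      (if a.fst = v then 1 else 0) - (if a.snd = v then 1 else 0) := by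
  simp only [unitFlow, Finset.sum_sub_distrib, Finset.sum_ite_eq', Finset.mem_filter,
    Finset.mem_univ, true_and]
  rfl

theorem Walk.sum_flow {u w : V} (p : G.Walk u w) (v : V) :
    ∑ e : G.Dart with e.fst = v, p.flow e =
      (if u = v then 1 else 0) - (if w = v then 1 else 0) := by
  induction p with
  | nil => simp
  | cons h p ih =>
    simp only [Walk.flow_cons, Finset.sum_add_distrib, ih, sum_unitFlow]
    ring

end Flow

namespace RotationSystem

theorem face_facePerm (R : G.RotationSystem) (d : G.Dart) :
    R.face (R.facePerm d) = R.face d := R.face_next_symm d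

variable [Fintype V] [DecidableEq V] [DecidableRel G.Adj] {R : G.RotationSystem}

theorem IsPlanar.exists_walk_potential (hR : R.IsPlanar) {u : V} (w : G.Walk u u) :
    ∃ h : R.FaceWalk → ℚ, ∀ d, w.flow d = h (R.face d) - h (R.face d.symm) :=
  hR.exists_face_potential w.flow_symm fun v => by rw [w.sum_flow, sub_self]

/-- A circulation vanishes on a dart if the faces on both sides of the dart have their third
vertices in a connected set of vertices that the circulation avoids. -/
theorem IsPlanar.circulation_eq_zero (hR : R.IsPlanar) {f : G.Dart → ℚ}
    (hf : ∀ d, f d.symm = - f d) (hc : ∀ v, ∑ d : G.Dart with d.fst = v, f d = 0) {B : Set V}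
    (hB : (G.induce B).Preconnected) (h0 : ∀ d : G.Dart, d.fst ∈ B → f d = 0) {d : G.Dart}
    (h1 : (R.facePerm d).snd ∈ B) (h2 : (R.facePerm d.symm).snd ∈ B) : f d = 0 := by
  obtain ⟨h, hh⟩ := hR.exists_face_potential hf hc
  -- `facePerm (facePerm d)` starts at the third vertex and lies on the face of `d`, so the two
  -- faces at the edge of `d` are compared through darts leaving `B`.
  have := R.face_const_of_reachable (h := h) (B := B)
    (fun e he => by linarith [hh e, h0 e he]) hB
    (d := R.facePerm (R.facePerm d)) (d' := R.facePerm (R.facePerm d.symm))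
    (by rwa [fst_facePerm]) (by rwa [fst_facePerm])
  simp only [face_facePerm] at this
  rw [hh, this, sub_self]

end RotationSystem

namespace IsMaximalPlanar

open RotationSystem

variable [Fintype V] (hG : G.IsMaximalPlanar) {R : G.RotationSystem} (hR : R.IsPlanar)

include hG hR

/-- The end of `d` is a leaf. Another neighbour of `d.fst` next in the rotation would share a face
with this leaf, hence be adjacent to it, which is impossible. So the edge is a whole component. -/
theorem facePerm_of_leaf {d : G.Dart} (hd : (R.facePerm d).snd = d.fst) :
    R.facePerm d = d.symm ∧ R.facePerm d.symm = d := by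
  have h1 : R.facePerm d = d.symm := Dart.ext_fst_snd (R.fst_facePerm d) hd
  refine ⟨h1, ?_⟩
  have h2 : ∀ e : G.Dart, e.fst = d.snd → e = d.symm := fun e he =>
    (Equiv.Perm.SameCycle.eq_of_left (R.sameCycle_next d.symm e he.symm) h1).symm
  set e := R.facePerm d.symm with he
  have h3 : e.fst = d.fst := R.fst_facePerm _
  refine Dart.ext_fst_snd h3 ?_
  by_contra hne
  have h4 : R.face d.symm = R.face (R.facePerm e) := by
    rw [R.face_facePerm, he, R.face_facePerm]
  have h5 := hG.adj_of_face_eq hR h4 (by rw [fst_facePerm]; exact Ne.symm hne)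
  rw [fst_facePerm] at h5
  have h6 := h2 ⟨(d.snd, e.snd), h5⟩ rfl
  have h7 : e.snd = d.fst := congrArg (fun e : G.Dart => e.snd) h6
  exact e.adj.ne (h3.trans h7.symm)

theorem snd_facePerm_ne {d : G.Dart} (hd : (R.facePerm d).snd ≠ d.fst) :
    (R.facePerm (R.facePerm d)).snd ≠ d.snd := by
  intro h
  obtain ⟨h1, h2⟩ := hG.facePerm_of_leaf hR (d := R.facePerm d) (by rw [h, fst_facePerm])
  rw [← h1] at h2
  have h3 := R.facePerm.injective h2
  rw [h1] at h3
  exact hd (congrArg (fun e : G.Dart => e.fst) h3)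

/-- Otherwise a face has four consecutive distinct vertices 0, 1, 2, 3, and maximality gives both
edges 02 and 13. The triangle 012 separates the edge 13 at its end 1 from the face at 3, although no
flow passes through 3. -/
theorem snd_facePerm_facePerm {d : G.Dart} (hd : (R.facePerm d).snd ≠ d.fst) :
    (R.facePerm (R.facePerm d)).snd = d.fst := by
  classical
  by_contra h30
  have h31 := hG.snd_facePerm_ne hR hd
  set a := R.facePerm d with ha
  set b := R.facePerm a with hb
  have ha1 : a.fst = d.snd := R.fst_facePerm _
  have hb1 : b.fst = a.snd := R.fst_facePerm _
  have hFa : R.face a = R.face d := R.face_facePerm _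
  have hFb : R.face b = R.face d := (R.face_facePerm _).trans hFa
  have hFc : R.face (R.facePerm b) = R.face d := (R.face_facePerm _).trans hFb
  have h20 : G.Adj a.snd d.fst := by
    rw [← hb1]
    exact hG.adj_of_face_eq hR hFb (by rwa [hb1])
  have h13 : G.Adj d.snd b.snd := by
    rw [← ha1, ← R.fst_facePerm b]
    exact hG.adj_of_face_eq hR (hFa.trans hFc.symm) (by rw [ha1, R.fst_facePerm b]; exact h31.symm)
  have h12 : G.Adj d.snd a.snd := ha1 ▸ a.adj
  have h23 : G.Adj a.snd b.snd := hb1 ▸ b.adj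
  obtain ⟨h, hh⟩ := hR.exists_walk_potential
    (Walk.cons d.adj (Walk.cons h12 (Walk.cons h20 Walk.nil)))
  have hea : (⟨(d.snd, a.snd), h12⟩ : G.Dart) = a := Dart.ext_fst_snd ha1.symm rfl
  have hed : (⟨(d.fst, d.snd), d.adj⟩ : G.Dart) = d := rfl
  simp only [Walk.flow_cons, Walk.flow_nil, hea, hed, add_zero] at hh
  set c : G.Dart := ⟨(a.snd, d.fst), h20⟩ with hc
  have n01 := d.adj.ne
  have n12 := h12.ne
  have n20 := h20.ne
  -- the values of the flow at the second and at the fourth vertex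
  have hat1 : ∀ e : G.Dart, e.fst = d.snd → e ≠ a → e ≠ d.symm →
      h (R.face e.symm) = h (R.face e) := by
    intro e he hea hed
    have e1 : unitFlow d e = 0 := by
      rw [unitFlow, if_neg (fun h => n01 (by rw [← he, h])), if_neg hed, sub_zero]
    have e2 : unitFlow a e = 0 := by
      rw [unitFlow, if_neg hea, if_neg (fun h => n12 (by rw [← he, h]; rfl)), sub_zero]
    have e3 : unitFlow c e = 0 := unitFlow_eq_zero (he ▸ n12) (he ▸ n01.symm)
    have := hh e
    rw [e1, e2, e3] at this
    linarith
  have hat3 : ∀ e : G.Dart, e.fst = b.snd → h (R.face e.symm) = h (R.face e) := by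
    intro e he
    have := hh e
    rw [unitFlow_eq_zero (he ▸ h30) (he ▸ h13.ne'),
      unitFlow_eq_zero (by rw [he, ha1]; exact h13.ne') (he ▸ h23.ne'),
      unitFlow_eq_zero (he ▸ h23.ne') (he ▸ h30)] at this
    linarith
  have hd' : h (R.face d.symm) = h (R.face d) - 1 := by
    have e1 : unitFlow d d = 1 := by
      rw [unitFlow, if_pos rfl, if_neg (fun h => n01 (congrArg (fun e : G.Dart => e.fst) h)),
        sub_zero]
    have e2 : unitFlow a d = 0 := by
      rw [← neg_eq_zero, ← unitFlow_symm]
      rw [unitFlow, if_neg (fun h => n20 (congrArg (fun e : G.Dart => e.snd) h).symm),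
        if_neg (fun h => n12 (congrArg (fun e : G.Dart => e.fst) h)), sub_zero]
    have e3 : unitFlow c d = 0 := by
      have m1 : d ≠ c := fun h => n20 (congrArg (fun e : G.Dart => e.fst) h).symm
      have m2 : d ≠ c.symm := fun h => by
        have h' := congrArg (fun e : G.Dart => e.snd) h
        exact n12 h'
      rw [unitFlow, if_neg m1, if_neg m2, sub_zero]
    have := hh d
    rw [e1, e2, e3] at this
    linarith
  have ha' : h (R.face a.symm) = h (R.face d) - 1 := by
    have e1 : unitFlow d a = 0 := by
      rw [unitFlow, if_neg (fun h => n01 (by rw [← ha1, h])),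
        if_neg (fun h => n20 (congrArg (fun e : G.Dart => e.snd) h)), sub_zero]
    have e2 : unitFlow a a = 1 := by
      rw [unitFlow, if_pos rfl, if_neg (fun h => n12 (by
        rw [← ha1]; exact congrArg (fun e : G.Dart => e.fst) h)), sub_zero]
    have e3 : unitFlow c a = 0 := by
      have m1 : a ≠ c := fun h => n12 (ha1 ▸ congrArg (fun e : G.Dart => e.fst) h)
      have m2 : a ≠ c.symm := fun h => n01 (ha1 ▸ (congrArg (fun e : G.Dart => e.fst) h).symm)
      rw [unitFlow, if_neg m1, if_neg m2, sub_zero]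
    have := hh a
    rw [e1, e2, e3, hFa] at this
    linarith
  -- At vertex 1 only the corner before `a` lies on the near side of the triangle. With the value at
  -- `a` replaced by the far value, the potential is invariant under the rotation.
  have key := eq_of_sameCycle (σ := R.next)
    (H := fun e => if e.fst = d.snd then
      some (if e = a then h (R.face d) - 1 else h (R.face e)) else none)
    (fun e => by
      rw [R.fst_next]
      split_ifs with he hna hea hea
      · rfl
      · rw [show e = d.symm from R.next.injective hna, hd']
      · rw [R.face_next, hea, ha']
      · rw [R.face_next, hat1 e he hea (fun h => hna (by rw [h]; rfl))]
      · rfl) (R.sameCycle_next d.symm ⟨(d.snd, b.snd), h13⟩ rfl)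
  have hda : d.symm ≠ a := fun h => n20 (congrArg (fun e : G.Dart => e.snd) h).symm
  have hga : (⟨(d.snd, b.snd), h13⟩ : G.Dart) ≠ a := fun h => h23.ne (congrArg (fun e : G.Dart => e.snd) h).symm
  have hgd : (⟨(d.snd, b.snd), h13⟩ : G.Dart) ≠ d.symm := fun h => h30 (congrArg (fun e : G.Dart => e.snd) h)
  have hs : d.symm.fst = d.snd := rfl
  simp only [hs, if_true, if_neg hda, if_neg hga, Option.some.injEq] at key
  rw [hd', ← hat1 _ rfl hga hgd] at key
  have := R.face_const_at hat3 (d := Dart.symm ⟨(d.snd, b.snd), h13⟩) (d' := R.facePerm b)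
    rfl (R.fst_facePerm b)
  rw [hFc] at this
  linarith

theorem facePerm_facePerm_facePerm {d : G.Dart} (hd : (R.facePerm d).snd ≠ d.fst) :
    R.facePerm (R.facePerm (R.facePerm d)) = d := by
  refine Dart.ext_fst_snd ?_ ?_
  · rw [fst_facePerm, hG.snd_facePerm_facePerm hR hd]
  · rw [hG.snd_facePerm_facePerm hR (d := R.facePerm d), fst_facePerm]
    rw [fst_facePerm]
    exact hG.snd_facePerm_ne hR hd

theorem facePerm_iterate_fst_mem {S : Set V} {d : G.Dart} (h1 : d.fst ∈ S) (h2 : d.snd ∈ S)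
    (h3 : (R.facePerm d).snd ∈ S) (n : ℕ) : (R.facePerm^[n] d).fst ∈ S := by
  have hcl : ∀ n, R.facePerm^[n] d = d ∨ R.facePerm^[n] d = R.facePerm d ∨
      R.facePerm^[n] d = R.facePerm (R.facePerm d) := by
    intro n
    induction n with
    | zero => exact Or.inl rfl
    | succ n ih =>
      rw [Function.iterate_succ_apply']
      rcases ih with h | h | h
      · exact Or.inr (Or.inl (by rw [h]))
      · exact Or.inr (Or.inr (by rw [h]))
      · rw [h]
        by_cases hl : (R.facePerm d).snd = d.fst
        · obtain ⟨e1, e2⟩ := hG.facePerm_of_leaf hR hl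
          exact Or.inr (Or.inl (by rw [e1, e2]; exact e1))
        · exact Or.inl (hG.facePerm_facePerm_facePerm hR hl)
  rcases hcl n with h | h | h <;> rw [h]
  · exact h1
  · rwa [fst_facePerm]
  · rwa [fst_facePerm]

end IsMaximalPlanar

end SimpleGraph

/-! ### Counting darts around a connected set -/

namespace SimpleGraph

open Finset

variable {V : Type*} {G : SimpleGraph V}

section CardDart

variable [Fintype V]

/-- An isomorphism of graphs maps darts to darts. -/
def Iso.dartEquiv {W : Type*} {G' : SimpleGraph W} (e : G ≃g G') : G.Dart ≃ G'.Dart where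
  toFun := e.toHom.mapDart
  invFun := e.symm.toHom.mapDart
  left_inv d := Dart.ext_fst_snd (e.symm_apply_apply d.fst) (e.symm_apply_apply d.snd)
  right_inv d := Dart.ext_fst_snd (e.apply_symm_apply d.fst) (e.apply_symm_apply d.snd)

theorem natCard_dart_induce [DecidableRel G.Adj] (T : Set V) [DecidablePred (· ∈ T)] :
    Nat.card (G.induce T).Dart = #{d : G.Dart | d.fst ∈ T ∧ d.snd ∈ T} := by
  rw [← Fintype.card_coe, ← Nat.card_eq_fintype_card]
  refine Nat.card_congr
    { toFun := fun d => ⟨⟨(d.fst.1, d.snd.1), d.adj⟩,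
        Finset.mem_filter_univ _ |>.2 ⟨d.fst.2, d.snd.2⟩⟩
      invFun := fun d => ⟨(⟨d.1.fst, ((Finset.mem_filter_univ _).1 d.2).1⟩,
        ⟨d.1.snd, ((Finset.mem_filter_univ _).1 d.2).2⟩), d.1.adj⟩
      left_inv := fun d => rfl
      right_inv := fun d => rfl }

theorem natCard_dart_cycleGraph {k : ℕ} (hk : 3 ≤ k) : Nat.card (cycleGraph k).Dart = 2 * k := by
  obtain ⟨n, rfl⟩ := Nat.exists_eq_add_of_le' hk
  rw [Nat.card_eq_fintype_card, dart_card_eq_sum_degrees]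
  simp [cycleGraph_degree_three_le, mul_comm]

theorem natCard_dart_pathGraph (m : ℕ) : Nat.card (pathGraph m).Dart = 2 * (m - 1) := by
  cases m with
  | zero =>
    have : IsEmpty (pathGraph 0).Dart := ⟨fun d => d.fst.elim0⟩
    simp
  | succ n =>
    let g : Fin n ⊕ Fin n → (pathGraph (n + 1)).Dart := Sum.elim
      (fun i => ⟨(i.castSucc, i.succ), pathGraph_adj.2 (Or.inl (by simp))⟩)
      (fun i => ⟨(i.succ, i.castSucc), pathGraph_adj.2 (Or.inr (by simp))⟩)
    have hg : Function.Bijective g := by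
      constructor
      · rintro (i | i) (j | j) h
        all_goals
          have h1 := congrArg (fun d : (pathGraph (n + 1)).Dart => d.fst.val) h
          have h2 := congrArg (fun d : (pathGraph (n + 1)).Dart => d.snd.val) h
          simp [g] at h1 h2
        · rw [Fin.ext h1]
        · omega
        · omega
        · rw [Fin.ext h1]
      · rintro ⟨⟨u, v⟩, h⟩
        rcases pathGraph_adj.1 h with h' | h'
        · exact ⟨.inl ⟨u, by have := v.2; simp at h'; omega⟩,
            Dart.ext_fst_snd (Fin.ext rfl) (Fin.ext h')⟩
        · exact ⟨.inr ⟨v, by have := u.2; simp at h'; omega⟩,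
            Dart.ext_fst_snd (Fin.ext h') (Fin.ext rfl)⟩
    rw [← Nat.card_congr (Equiv.ofBijective g hg), Nat.card_sum, Nat.card_fin]
    omega

end CardDart

section Cycle

variable {T : Set V} {k : ℕ}

theorem InducesCycle.ncard_eq (hT : G.InducesCycle T k) : T.ncard = k := by
  obtain ⟨-, ⟨e⟩⟩ := hT
  rw [← Nat.card_coe_set_eq, Nat.card_congr e.toEquiv, Nat.card_fin]

theorem InducesCycle.preconnected (hT : G.InducesCycle T k) : (G.induce T).Preconnected := by
  obtain ⟨-, ⟨e⟩⟩ := hT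
  exact e.preconnected_iff.2 cycleGraph_preconnected

theorem InducesCycle.exists_adj (hT : G.InducesCycle T k) {x : V} (hx : x ∈ T) :
    ∃ y ∈ T, G.Adj x y := by
  obtain ⟨hk, ⟨e⟩⟩ := hT
  obtain ⟨n, rfl⟩ := Nat.exists_eq_add_of_le' hk
  have h : (cycleGraph (n + 3)).Adj (e ⟨x, hx⟩) (e ⟨x, hx⟩ + 1) :=
    (cycleGraph_adj (n := n + 1)).2 (Or.inr (by simp))
  refine ⟨(e.symm (e ⟨x, hx⟩ + 1)).1, (e.symm (e ⟨x, hx⟩ + 1)).2, ?_⟩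
  have h' := e.symm.map_adj_iff.2 h
  rw [e.symm_apply_apply] at h'
  exact h'

/-- An induced cycle carries a circulation. -/
theorem InducesCycle.exists_circulation [Fintype V] [DecidableEq V] [DecidableRel G.Adj]
    (hT : G.InducesCycle T k) :
    ∃ f : G.Dart → ℚ, (∀ d, f d.symm = - f d) ∧
      (∀ v, ∑ d : G.Dart with d.fst = v, f d = 0) ∧
      (∀ d : G.Dart, d.fst ∉ T → f d = 0) ∧
      ∀ d : G.Dart, d.fst ∈ T → d.snd ∈ T → f d ≠ 0 := by
  obtain ⟨hk, ⟨e⟩⟩ := hT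
  obtain ⟨n, rfl⟩ := Nat.exists_eq_add_of_le' hk
  have hadj : ∀ i : Fin (n + 3), G.Adj (e.symm i).1 (e.symm (i + 1)).1 := fun i =>
    e.symm.map_adj_iff.2 ((cycleGraph_adj (n := n + 1)).2 (Or.inr (by simp)))
  let a : Fin (n + 3) → G.Dart := fun i => ⟨((e.symm i).1, (e.symm (i + 1)).1), hadj i⟩
  have hsymm : ∀ d : G.Dart,
      ∑ i, unitFlow (a i) d.symm = - ∑ i, unitFlow (a i) d := fun d => by
    simp [unitFlow_symm]
  have hinj : ∀ {i j}, (e.symm i).1 = (e.symm j).1 → i = j := fun h =>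
    e.symm.injective (Subtype.ext h)
  have hone : ∀ i, ∑ j, unitFlow (a j) (a i) = 1 := by
    intro i
    rw [Finset.sum_eq_single i]
    · rw [unitFlow, if_pos rfl, if_neg (Dart.symm_ne _).symm, sub_zero]
    · intro j _ hji
      have h1 : a i ≠ a j := fun h => hji (hinj (congrArg (fun d : G.Dart => d.fst) h)).symm
      have h2 : a i ≠ (a j).symm := fun h => by
        have h3 : i = j + 1 := hinj (congrArg (fun d : G.Dart => d.fst) h)
        have h4 : i + 1 = j := hinj (congrArg (fun d : G.Dart => d.snd) h)
        -- Traversing an edge in both directions would need `1 + 1 = 0`, which fails modulo `n + 3`.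
        rw [h3, add_assoc, add_eq_left] at h4
        have h5 := congrArg Fin.val h4
        rw [Fin.val_add, Fin.val_one, Fin.val_zero, Nat.mod_eq_of_lt (by omega)] at h5
        omega
      rw [unitFlow, if_neg h1, if_neg h2, sub_zero]
    · simp
  refine ⟨fun d => ∑ i, unitFlow (a i) d, hsymm, fun v => ?_, fun d hd => ?_, fun d h1 h2 => ?_⟩
  · rw [Finset.sum_comm]
    simp only [sum_unitFlow, Finset.sum_sub_distrib]
    rw [sub_eq_zero]
    exact (Equiv.sum_comp (Equiv.addRight (1 : Fin (n + 3)))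
      fun i => if (e.symm i).1 = v then (1 : ℚ) else 0).symm
  · refine Finset.sum_eq_zero fun i _ => unitFlow_eq_zero ?_ ?_
    · exact fun h => hd (h ▸ (e.symm i).2)
    · exact fun h => hd (h ▸ (e.symm (i + 1)).2)
  · have h : (cycleGraph (n + 3)).Adj (e ⟨_, h1⟩) (e ⟨_, h2⟩) := e.map_adj_iff.2 d.adj
    have key : ∀ i j : Fin (n + 3), j - i = 1 → j = i + 1 := fun i j h => by rw [← h]; abel
    rcases (cycleGraph_adj (n := n + 1)).1 h with h | h
    · have hd : d = (a (e ⟨_, h2⟩)).symm := by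
        refine Dart.ext_fst_snd ?_ ?_
        · change _ = (e.symm (e ⟨_, h2⟩ + 1)).1
          rw [← key _ _ h, e.symm_apply_apply]
        · change _ = (e.symm (e ⟨_, h2⟩)).1
          rw [e.symm_apply_apply]
      have := hsymm (a (e ⟨_, h2⟩))
      rw [← hd, hone] at this
      exact this.trans_ne (by norm_num)
    · have hd : d = a (e ⟨_, h1⟩) := by
        refine Dart.ext_fst_snd ?_ ?_
        · change _ = (e.symm (e ⟨_, h1⟩)).1
          rw [e.symm_apply_apply]
        · change _ = (e.symm (e ⟨_, h1⟩ + 1)).1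
          rw [← key _ _ h, e.symm_apply_apply]
      have := hone (e ⟨_, h1⟩)
      rw [← hd] at this
      exact this.trans_ne one_ne_zero

end Cycle

namespace RotationSystem

variable [Fintype V] [DecidableEq V] [DecidableRel G.Adj] (R : G.RotationSystem) (S : Finset V)

/-- The darts from `S` to its complement. -/
def outDarts (G : SimpleGraph V) [DecidableRel G.Adj] (S : Finset V) : Finset G.Dart :=
  {d | d.fst ∈ S ∧ d.snd ∉ S}

/-- The darts between vertices of `S` on a triangle with third vertex outside `S`. -/
def innerDarts : Finset G.Dart := {d | d.fst ∈ S ∧ d.snd ∈ S ∧ (R.facePerm d).snd ∉ S}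

/-- The darts between vertices outside `S` on a triangle with third vertex in `S`. -/
def outerDarts : Finset G.Dart := {d | d.fst ∉ S ∧ d.snd ∉ S ∧ (R.facePerm d).snd ∈ S}

variable {S}

theorem mem_outDarts {d : G.Dart} : d ∈ outDarts G S ↔ d.fst ∈ S ∧ d.snd ∉ S := by
  simp [outDarts]

variable {R}

theorem mem_innerDarts {d : G.Dart} :
    d ∈ R.innerDarts S ↔ d.fst ∈ S ∧ d.snd ∈ S ∧ (R.facePerm d).snd ∉ S := by
  rw [innerDarts, Finset.mem_filter_univ]

theorem mem_outerDarts {d : G.Dart} :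
    d ∈ R.outerDarts S ↔ d.fst ∉ S ∧ d.snd ∉ S ∧ (R.facePerm d).snd ∈ S := by
  rw [outerDarts, Finset.mem_filter_univ]

variable (G S) in
theorem card_outDarts :
    #(outDarts G S) + ∑ v : (S : Set V), (G.induce (S : Set V)).degree v =
      ∑ v ∈ S, G.degree v := by
  have h1 : ∑ v ∈ S, G.degree v = #{d : G.Dart | d.fst ∈ S} := by
    rw [Finset.card_eq_sum_card_fiberwise (f := fun d : G.Dart => d.fst) (t := S) (by
      intro d hd; simpa using hd)]
    refine Finset.sum_congr rfl fun v hv => ?_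
    rw [← G.dart_fst_fiber_card_eq_degree v]
    congr 1
    ext d
    simp only [Finset.mem_filter, Finset.mem_univ, true_and]
    exact ⟨fun h => ⟨h ▸ hv, h⟩, fun h => h.2⟩
  rw [← dart_card_eq_sum_degrees, ← Nat.card_eq_fintype_card, natCard_dart_induce, h1,
    ← Finset.card_filter_add_card_filter_not (s := {d : G.Dart | d.fst ∈ S}) (fun d => d.snd ∉ S)]
  simp [Finset.filter_filter, outDarts]

end RotationSystem

namespace IsMaximalPlanar

open RotationSystem

variable [Fintype V] [DecidableEq V] [DecidableRel G.Adj] (hG : G.IsMaximalPlanar)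
  {R : G.RotationSystem} (hR : R.IsPlanar) {S : Finset V} {k : ℕ}

include hG hR

/-- On a triangle with a dart from `s` in `S` to `x` outside, the third vertex `t` decides: if `t`
is in `S` the dart `ts` is inner, otherwise `xt` is outer. Rotation of the triangle inverts both
assignments. -/
theorem card_outDarts_eq
    (hout : ∀ d ∈ outDarts G S, (R.facePerm d).snd ≠ d.fst) :
    #(outDarts G S) = #(R.innerDarts S) + #(R.outerDarts S) := by
  have hin : ∀ d ∈ R.innerDarts S, (R.facePerm d).snd ≠ d.fst := fun d hd h =>
    (mem_innerDarts.1 hd).2.2 (h ▸ (mem_innerDarts.1 hd).1)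
  have hex : ∀ d ∈ R.outerDarts S, (R.facePerm d).snd ≠ d.fst := fun d hd h =>
    (mem_outerDarts.1 hd).1 (h ▸ (mem_outerDarts.1 hd).2.2)
  rw [← Finset.card_filter_add_card_filter_not (s := outDarts G S)
    (fun d => (R.facePerm d).snd ∈ S)]
  congr 1
  · refine Finset.card_nbij' (fun d => R.facePerm (R.facePerm d)) R.facePerm ?_ ?_ ?_ ?_
    · intro d hd
      obtain ⟨hd, hd3⟩ := Finset.mem_filter.1 hd
      obtain ⟨hd1, hd2⟩ := mem_outDarts.1 hd
      refine mem_innerDarts.2 ⟨by rwa [fst_facePerm], ?_, ?_⟩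
      · rwa [hG.snd_facePerm_facePerm hR (hout d hd)]
      · rwa [hG.facePerm_facePerm_facePerm hR (hout d hd)]
    · intro d hd
      obtain ⟨hd1, hd2, hd3⟩ := mem_innerDarts.1 hd
      refine Finset.mem_filter.2 ⟨mem_outDarts.2 ⟨by rwa [fst_facePerm], hd3⟩, ?_⟩
      rwa [hG.snd_facePerm_facePerm hR (hin d hd)]
    · intro d hd
      exact hG.facePerm_facePerm_facePerm hR (hout d (Finset.mem_filter.1 hd).1)
    · intro d hd
      exact hG.facePerm_facePerm_facePerm hR (hin d hd)
  · refine Finset.card_nbij' R.facePerm (fun d => R.facePerm (R.facePerm d)) ?_ ?_ ?_ ?_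
    · intro d hd
      obtain ⟨hd, hd3⟩ := Finset.mem_filter.1 hd
      obtain ⟨hd1, hd2⟩ := mem_outDarts.1 hd
      refine mem_outerDarts.2 ⟨by rwa [fst_facePerm], hd3, ?_⟩
      rwa [hG.snd_facePerm_facePerm hR (hout d hd)]
    · intro d hd
      obtain ⟨hd1, hd2, hd3⟩ := mem_outerDarts.1 hd
      refine Finset.mem_filter.2 ⟨mem_outDarts.2 ⟨by rwa [fst_facePerm], ?_⟩, ?_⟩
      · rwa [hG.snd_facePerm_facePerm hR (hex d hd)]
      · rwa [hG.facePerm_facePerm_facePerm hR (hex d hd)]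
    · intro d hd
      exact hG.facePerm_facePerm_facePerm hR (hout d (Finset.mem_filter.1 hd).1)
    · intro d hd
      exact hG.facePerm_facePerm_facePerm hR (hex d hd)

theorem mem_nbrSet_of_mem_outerDarts {d : G.Dart} (hd : d ∈ R.outerDarts S) :
    d.fst ∈ G.nbrSet (S : Set V) ∧ d.snd ∈ G.nbrSet (S : Set V) := by
  obtain ⟨h1, h2, h3⟩ := mem_outerDarts.1 hd
  have h4 := hG.snd_facePerm_facePerm hR (d := d) (fun h => h1 (h ▸ h3))
  refine ⟨⟨h1, _, h3, ?_⟩, h2, _, h3, ?_⟩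
  · rw [← h4, ← R.fst_facePerm (R.facePerm d)]
    exact (R.facePerm (R.facePerm d)).adj
  · rw [← R.fst_facePerm d]
    exact (R.facePerm d).adj.symm

variable (hC : G.InducesCycle (G.nbrSet (S : Set V)) k)

include hC

/-- The end of `d` lies on `C` and has a neighbour there besides `d.fst`, so it is not a leaf. -/
theorem snd_facePerm_ne_of_mem_outDarts {d : G.Dart} (hd : d ∈ outDarts G S) :
    (R.facePerm d).snd ≠ d.fst := by
  obtain ⟨h1, h2⟩ := mem_outDarts.1 hd
  intro h
  have h3 := (hG.facePerm_of_leaf hR h).1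
  obtain ⟨y, hy, hadj⟩ := hC.exists_adj (x := d.snd) ⟨h2, d.fst, h1, d.adj⟩
  have h4 := Equiv.Perm.SameCycle.eq_of_left (R.sameCycle_next d.symm ⟨(d.snd, y), hadj⟩ rfl) h3
  have h5 : d.fst = y := congrArg (fun e : G.Dart => e.snd) h4
  exact hy.1 (h5 ▸ h1)

/-- Rotation around `x` from a neighbour in `S` to a neighbour on `C` must at some step leave `S`;
the triangle at that corner supplies the dart. -/
theorem exists_outerDart {x : V} (hx : x ∈ G.nbrSet (S : Set V)) :
    ∃ d ∈ R.outerDarts S, d.fst = x := by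
  obtain ⟨y, hy, hxy⟩ := hC.exists_adj hx
  obtain ⟨hxS, s, hs, hsx⟩ := hx
  obtain ⟨n, hn⟩ := exists_iterate_eq
    (R.sameCycle_next ⟨(x, s), hsx.symm⟩ ⟨(x, y), hxy⟩ rfl)
  obtain ⟨d, hd, hdS, hdS'⟩ : ∃ d : G.Dart, d.fst = x ∧ d.snd ∈ S ∧ (R.next d).snd ∉ S := by
    by_contra! hcon
    have hind : ∀ n : ℕ, (R.next^[n] ⟨(x, s), hsx.symm⟩).fst = x ∧
        (R.next^[n] ⟨(x, s), hsx.symm⟩).snd ∈ S := by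
      intro n
      induction n with
      | zero => exact ⟨rfl, hs⟩
      | succ n ih =>
        rw [Function.iterate_succ_apply']
        exact ⟨by rw [R.fst_next, ih.1], hcon _ ih.1 ih.2⟩
    have := (hind n).2
    rw [hn] at this
    exact hy.1 this
  have hout : d.symm ∈ outDarts G S := mem_outDarts.2 ⟨hdS, by
    change d.fst ∉ S
    rw [hd]; exact hxS⟩
  have hφ : R.facePerm d.symm = R.next d := by rw [facePerm_apply, Dart.symm_symm]
  have h3 := hG.snd_facePerm_facePerm hR (hG.snd_facePerm_ne_of_mem_outDarts hR hC hout)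
  rw [hφ] at h3
  refine ⟨R.next d, mem_outerDarts.2 ⟨?_, hdS', ?_⟩, by rw [R.fst_next, hd]⟩
  · rw [R.fst_next, hd]; exact hxS
  · rw [h3]; exact hdS

/-- At most `k`: outer darts run along `C`, and a dart and its reverse cannot both be outer, since
the circulation along `C` avoids the connected set `S`. At least `k`: every vertex of `C` starts an
outer dart. -/
theorem card_outerDarts (hS : (G.induce (S : Set V)).Preconnected) :
    #(R.outerDarts S) = k := by
  classical
  apply le_antisymm
  · obtain ⟨f, hf, hfc, hf0, hf1⟩ := hC.exists_circulation
    have hdisj : Disjoint (R.outerDarts S) ((R.outerDarts S).image Dart.symm) := by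
      rw [Finset.disjoint_left]
      intro d hd hd'
      obtain ⟨e, he, rfl⟩ := Finset.mem_image.1 hd'
      obtain ⟨h1, h2⟩ := hG.mem_nbrSet_of_mem_outerDarts hR he
      refine hf1 e h1 h2 (hR.circulation_eq_zero hf hfc hS (fun d hd => hf0 d fun h => h.1 hd)
        (mem_outerDarts.1 he).2.2 (mem_outerDarts.1 hd).2.2)
    have hsub : R.outerDarts S ∪ (R.outerDarts S).image Dart.symm ⊆
        ({d : G.Dart | d.fst ∈ G.nbrSet (S : Set V) ∧ d.snd ∈ G.nbrSet (S : Set V)} : Finset _) := by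
      intro d hd
      simp only [Finset.mem_filter, Finset.mem_univ, true_and]
      rcases Finset.mem_union.1 hd with hd | hd
      · exact hG.mem_nbrSet_of_mem_outerDarts hR hd
      · obtain ⟨e, he, rfl⟩ := Finset.mem_image.1 hd
        exact (hG.mem_nbrSet_of_mem_outerDarts hR he).symm
    have hcard := Finset.card_le_card hsub
    obtain ⟨hk, ⟨e⟩⟩ := hC
    rw [Finset.card_union_of_disjoint hdisj,
      Finset.card_image_of_injective _ Dart.symm_involutive.injective, ← natCard_dart_induce,
      Nat.card_congr e.dartEquiv, natCard_dart_cycleGraph hk] at hcard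
    omega
  · rw [← hC.ncard_eq, ← Set.ncard_coe_finset]
    refine (Set.ncard_le_ncard (t := (fun d : G.Dart => d.fst) '' (R.outerDarts S)) ?_
      (Set.toFinite _)).trans (Set.ncard_image_le (Set.toFinite _))
    intro x hx
    obtain ⟨d, hd, rfl⟩ := hG.exists_outerDart hR hC hx
    exact ⟨d, hd, rfl⟩

/-- The length of the cycle around a connected subgraph of a maximal planar graph. -/
theorem sum_degree_eq (hS : (G.induce (S : Set V)).Preconnected) :
    ∑ v ∈ S, G.degree v =
      #(R.innerDarts S) + k + ∑ v : (S : Set V), (G.induce (S : Set V)).degree v := by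
  rw [← card_outDarts, hG.card_outDarts_eq hR fun d hd =>
    hG.snd_facePerm_ne_of_mem_outDarts hR hC hd, hG.card_outerDarts hR hC hS]

end IsMaximalPlanar

end SimpleGraph

/-! ### Inner darts and the boundary length -/

namespace SimpleGraph

open Finset

variable {V : Type*} {G : SimpleGraph V}

namespace RotationSystem

variable [Fintype V] [DecidableEq V] [DecidableRel G.Adj] {R : G.RotationSystem} {S : Finset V}
  {k : ℕ}

/-- If the edge is not a bridge, it closes up to a closed walk in `S` that uses it once. Its flow
avoids the connected set `C`, which has vertices on both sides of the edge, so it would vanish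
there. -/
theorem IsPlanar.isBridge_of_mem_innerDarts (hR : R.IsPlanar)
    (hC : G.InducesCycle (G.nbrSet (S : Set V)) k) {u v : (S : Set V)} (huv : G.Adj u v)
    (h1 : (⟨(u, v), huv⟩ : G.Dart) ∈ R.innerDarts S)
    (h2 : (⟨(v, u), huv.symm⟩ : G.Dart) ∈ R.innerDarts S) :
    (G.induce (S : Set V)).IsBridge s(u, v) := by
  rw [isBridge_iff, reachable_deleteEdges_iff_exists_walk]
  rintro ⟨p, hp⟩
  let q : G.Walk (u : V) v := p.map (Embedding.induce (S : Set V)).toHom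
  have hq : (⟨(u, v), huv⟩ : G.Dart).edge ∉ q.edges := fun h => by
    rw [show q.edges = _ from Walk.edges_map _ _, List.mem_map] at h
    obtain ⟨e, he, h'⟩ := h
    have : e = s(u, v) := Sym2.map.injective Subtype.val_injective h'
    exact hp (this ▸ he)
  let w : G.Walk (v : V) v := Walk.cons huv.symm q
  have hw : ∀ x ∈ w.support, x ∈ S := by
    intro x hx
    rw [Walk.support_cons, List.mem_cons, show q.support = _ from Walk.support_map _ _,
      List.mem_map] at hx
    obtain rfl | ⟨y, -, rfl⟩ := hx
    · exact v.2
    · exact y.2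
  have happ : ∀ d ∈ R.innerDarts S, (R.facePerm d).snd ∈ G.nbrSet (S : Set V) := fun d hd => by
    refine ⟨(mem_innerDarts.1 hd).2.2, d.snd, (mem_innerDarts.1 hd).2.1, ?_⟩
    have := (R.facePerm d).adj
    rwa [fst_facePerm] at this
  have hz := hR.circulation_eq_zero w.flow_symm (fun x => by rw [w.sum_flow, sub_self])
    hC.preconnected (fun d hd => w.flow_eq_zero fun h => hd.1 (hw _ h)) (happ _ h1) (happ _ h2)
  rw [Walk.flow_cons, q.flow_eq_zero_of_notMem_edges hq, unitFlow, if_neg, if_pos] at hz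
  · norm_num at hz
  · rfl
  · exact fun h => huv.ne (congrArg (fun e : G.Dart => e.fst) h)

end RotationSystem

namespace IsMaximalPlanar

open RotationSystem

variable [Fintype V] [DecidableEq V] [DecidableRel G.Adj] (hG : G.IsMaximalPlanar)
  {R : G.RotationSystem} (hR : R.IsPlanar) {S : Finset V} {k : ℕ}

include hG hR

theorem exists_onFaceOf_iff {d : G.Dart} (h1 : d.fst ∈ S) (h2 : d.snd ∈ S) :
    (∃ v, v ∉ (S : Set V) ∧ R.OnFaceOf d v) ↔ d ∈ R.innerDarts S := by
  constructor
  · rintro ⟨v, hv, d', hd', rfl⟩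
    refine mem_innerDarts.2 ⟨h1, h2, fun h3 => hv ?_⟩
    obtain ⟨n, rfl⟩ := exists_iterate_eq hd'
    exact hG.facePerm_iterate_fst_mem hR h1 h2 h3 n
  · intro hd
    refine ⟨(R.facePerm d).snd, (mem_innerDarts.1 hd).2.2, R.facePerm (R.facePerm d), ?_,
      R.fst_facePerm _⟩
    exact Equiv.Perm.sameCycle_apply_right.2
      (Equiv.Perm.sameCycle_apply_right.2 (Equiv.Perm.SameCycle.refl _ _))

/-- A third vertex in `S` on the other side would give a detour of length two around the bridge. -/
theorem symm_mem_innerDarts_of_isBridge {u v : (S : Set V)} (huv : G.Adj u v)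
    (hb : (G.induce (S : Set V)).IsBridge s(u, v))
    (hd : (⟨(u, v), huv⟩ : G.Dart) ∈ R.innerDarts S) :
    (⟨(v, u), huv.symm⟩ : G.Dart) ∈ R.innerDarts S := by
  refine mem_innerDarts.2 ⟨v.2, u.2, fun hz => ?_⟩
  set d : G.Dart := ⟨(v, u), huv.symm⟩ with hd_def
  have hne : (R.facePerm d).snd ≠ d.fst := fun h => by
    have h1 := (hG.facePerm_of_leaf hR h).2
    have h2 : R.facePerm (⟨(u, v), huv⟩ : G.Dart) = d := h1
    have h3 := (mem_innerDarts.1 hd).2.2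
    rw [h2] at h3
    exact h3 u.2
  have hadj1 : G.Adj u (R.facePerm d).snd := by
    have := (R.facePerm d).adj
    rwa [fst_facePerm] at this
  have hadj2 : G.Adj (R.facePerm d).snd v := by
    have := (R.facePerm (R.facePerm d)).adj
    rwa [fst_facePerm, hG.snd_facePerm_facePerm hR hne] at this
  let z : (S : Set V) := ⟨(R.facePerm d).snd, hz⟩
  have a1 : (G.induce (S : Set V)).Adj u z := hadj1
  have a2 : (G.induce (S : Set V)).Adj z v := hadj2
  refine isBridge_iff.1 hb ((Adj.reachable (v := z) ?_).trans (Adj.reachable ?_))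
  · rw [deleteEdges_adj]
    refine ⟨a1, fun h => ?_⟩
    rcases Sym2.eq_iff.1 h with ⟨-, h⟩ | ⟨h, -⟩
    · exact a2.ne h
    · exact huv.ne (congrArg Subtype.val h)
  · rw [deleteEdges_adj]
    refine ⟨a2, fun h => ?_⟩
    rcases Sym2.eq_iff.1 h with ⟨h, -⟩ | ⟨-, h⟩
    · exact a1.ne h.symm
    · exact huv.ne (congrArg Subtype.val h).symm

variable (hC : G.InducesCycle (G.nbrSet (S : Set V)) k)

include hC

theorem boundaryLength_eq : R.boundaryLength (S : Set V) = #(R.innerDarts S) := by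
  classical
  have hinj : Function.Injective (Sym2.map (Subtype.val : ↥(S : Set V) → V)) :=
    Sym2.map.injective Subtype.val_injective
  have hmem : ∀ {u v : (S : Set V)} (huv : G.Adj u v),
      s(u, v) ∈ R.boundaryEdges (S : Set V) ↔
        (⟨(u, v), huv⟩ : G.Dart) ∈ R.innerDarts S ∨
        (⟨(v, u), huv.symm⟩ : G.Dart) ∈ R.innerDarts S := by
    intro u v huv
    constructor
    · rintro ⟨-, d, hd, hv⟩
      rcases (dart_edge_eq_iff d ⟨(u, v), huv⟩).1 hd with rfl | rfl
      · exact Or.inl ((hG.exists_onFaceOf_iff hR u.2 v.2).1 hv)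
      · exact Or.inr ((hG.exists_onFaceOf_iff hR (d := ⟨(v, u), huv.symm⟩) v.2 u.2).1 hv)
    · rintro (h | h)
      · exact ⟨huv, ⟨(u, v), huv⟩, rfl, (hG.exists_onFaceOf_iff hR u.2 v.2).2 h⟩
      · exact ⟨huv, ⟨(v, u), huv.symm⟩, Sym2.eq_swap,
          (hG.exists_onFaceOf_iff hR v.2 u.2).2 h⟩
  let B : Finset (Sym2 (S : Set V)) := (R.boundaryEdges (S : Set V)).toFinset
  have hmaps : Set.MapsTo Dart.edge (R.innerDarts S : Set G.Dart)
      (B.image (Sym2.map Subtype.val) : Finset (Sym2 V)) := by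
    intro d hd
    obtain ⟨h1, h2, -⟩ := mem_innerDarts.1 hd
    refine Finset.mem_coe.2 (Finset.mem_image.2 ⟨s(⟨d.fst, h1⟩, ⟨d.snd, h2⟩), ?_, rfl⟩)
    exact Set.mem_toFinset.2 ((hmem (u := ⟨d.fst, h1⟩) (v := ⟨d.snd, h2⟩) d.adj).2 (Or.inl hd))
  -- A boundary edge carries one inner dart, or two exactly when it is a bridge; this is the double
  -- counting in `boundaryLength`.
  have hfib : ∀ e ∈ B, #{d ∈ R.innerDarts S | d.edge = e.map Subtype.val} =
      1 + if (G.induce (S : Set V)).IsBridge e then 1 else 0 := by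
    intro e he
    have he' := Set.mem_toFinset.1 he
    induction e with
    | h u v =>
      have huv : G.Adj u v := he'.1
      let d₁ : G.Dart := ⟨(u, v), huv⟩
      let d₂ : G.Dart := ⟨(v, u), huv.symm⟩
      have hne : d₁ ≠ d₂ := fun h => huv.ne (congrArg (fun e : G.Dart => e.fst) h)
      have hset : ({d ∈ R.innerDarts S | d.edge = s(u, v).map Subtype.val} : Finset G.Dart) =
          {d ∈ ({d₁, d₂} : Finset G.Dart) | d ∈ R.innerDarts S} := by
        ext d
        have : d.edge = s(u, v).map Subtype.val ↔ d = d₁ ∨ d = d₂ := dart_edge_eq_iff d d₁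
        simp only [Finset.mem_filter, this, Finset.mem_insert, Finset.mem_singleton, and_comm]
      have hb1 : (G.induce (S : Set V)).IsBridge s(u, v) → d₁ ∈ R.innerDarts S →
          d₂ ∈ R.innerDarts S := hG.symm_mem_innerDarts_of_isBridge hR huv
      have hb2 : (G.induce (S : Set V)).IsBridge s(u, v) → d₂ ∈ R.innerDarts S →
          d₁ ∈ R.innerDarts S := fun h =>
        hG.symm_mem_innerDarts_of_isBridge hR huv.symm (Sym2.eq_swap ▸ h)
      have hb3 : d₁ ∈ R.innerDarts S → d₂ ∈ R.innerDarts S →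
          (G.induce (S : Set V)).IsBridge s(u, v) := hR.isBridge_of_mem_innerDarts hC huv
      have hor : d₁ ∈ R.innerDarts S ∨ d₂ ∈ R.innerDarts S := (hmem huv).1 he'
      rw [hset, Finset.filter_insert, Finset.filter_singleton]
      by_cases m1 : d₁ ∈ R.innerDarts S <;> by_cases m2 : d₂ ∈ R.innerDarts S
      · rw [if_pos (hb3 m1 m2)]
        simp [m1, m2, hne]
      · have : ¬ (G.induce (S : Set V)).IsBridge s(u, v) := fun h => m2 (hb1 h m1)
        rw [if_neg this]
        simp [m1, m2]
      · have : ¬ (G.induce (S : Set V)).IsBridge s(u, v) := fun h => m1 (hb2 h m2)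
        rw [if_neg this]
        simp [m1, m2]
      · exact absurd hor (by tauto)
  rw [Finset.card_eq_sum_card_fiberwise hmaps, Finset.sum_image (fun a _ b _ h => hinj h),
    Finset.sum_congr rfl hfib, Finset.sum_add_distrib, Finset.sum_const, smul_eq_mul, mul_one,
    ← Finset.card_filter, boundaryLength, Set.ncard_eq_toFinset_card', Set.ncard_eq_toFinset_card']
  congr 2
  ext e
  simp [B]

/-- In a maximal planar graph no triangle at a dart of a triangle-free `S` has all its vertices
in `S`. -/
theorem card_innerDarts_of_triangleFree (hS : (G.induce (S : Set V)).Preconnected)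
    (hfree : ∀ x y z : (S : Set V), G.Adj x y → G.Adj y z → ¬ G.Adj z x) :
    #(R.innerDarts S) = ∑ v : (S : Set V), (G.induce (S : Set V)).degree v := by
  rw [← dart_card_eq_sum_degrees, ← Nat.card_eq_fintype_card, natCard_dart_induce]
  congr 1
  ext d
  rw [mem_innerDarts, Finset.mem_filter_univ]
  refine ⟨fun h => ⟨h.1, h.2.1⟩, fun ⟨h1, h2⟩ => ⟨h1, h2, fun h3 => ?_⟩⟩
  -- If the face is not a triangle, the edge of `d` is a whole component and contains the connected
  -- set `S`, which then has no neighbours, although `C` is nonempty.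
  by_cases hl : (R.facePerm d).snd = d.fst
  · obtain ⟨e1, e2⟩ := hG.facePerm_of_leaf hR hl
    have hn1 : ∀ e : G.Dart, e.fst = d.fst → e.snd = d.snd := fun e he => by
      have e2' : R.next d = d := by simpa using e2
      rw [← Equiv.Perm.SameCycle.eq_of_left (R.sameCycle_next d e he.symm) e2']
    have hn2 : ∀ e : G.Dart, e.fst = d.snd → e.snd = d.fst := fun e he => by
      have := Equiv.Perm.SameCycle.eq_of_left (R.sameCycle_next d.symm e he.symm) e1
      rw [← this]
      rfl
    have hcl : ∀ {x y : V}, G.Adj x y → (x = d.fst ∨ x = d.snd) → (y = d.fst ∨ y = d.snd) := by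
      rintro x y hxy (rfl | rfl)
      · exact Or.inr (hn1 ⟨(_, y), hxy⟩ rfl)
      · exact Or.inl (hn2 ⟨(_, y), hxy⟩ rfl)
    have hcl' : ∀ {x y : (S : Set V)}, (G.induce (S : Set V)).Walk x y →
        (x.1 = d.fst ∨ x.1 = d.snd) → (y.1 = d.fst ∨ y.1 = d.snd) := by
      intro x y w
      induction w with
      | nil => exact id
      | cons h p ih => exact fun hx => ih (hcl h hx)
    obtain ⟨c, hc⟩ : (G.nbrSet (S : Set V)).Nonempty := by
      rw [Set.nonempty_iff_ne_empty]
      intro h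
      have h4 := hC.ncard_eq
      rw [h, Set.ncard_empty] at h4
      have := hC.1
      omega
    obtain ⟨hcS, s, hs, hsc⟩ := hc
    obtain ⟨w⟩ := hS ⟨d.fst, h1⟩ ⟨s, hs⟩
    rcases hcl hsc (hcl' w (Or.inl rfl)) with rfl | rfl
    · exact hcS h1
    · exact hcS h2
  · refine hfree ⟨_, h1⟩ ⟨_, h2⟩ ⟨_, h3⟩ d.adj ?_ ?_
    · have := (R.facePerm d).adj
      rwa [fst_facePerm] at this
    · have := (R.facePerm (R.facePerm d)).adj
      rwa [fst_facePerm, hG.snd_facePerm_facePerm hR hl] at this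

end IsMaximalPlanar

end SimpleGraph

/-! ### The two length formulas -/

theorem theorem6p2 {V : Type*} [Fintype V] [DecidableEq V] (G : SimpleGraph V)
    [DecidableRel G.Adj] (hG : G.IsMaximalPlanar) :
    -- induced paths `v 0, …, v (m - 1)` with `m` vertices
    (∀ (m : ℕ) (v : SimpleGraph.pathGraph m ↪g G) (k : ℕ),
      G.InducesCycle (G.nbrSet (Set.range v)) k →
        (k : ℤ) = ∑ i, (G.degree (v i) : ℤ) - 4 * ((m : ℤ) - 1) ∧
        (Even k ↔ Even (Finset.univ.filter fun i => Odd (G.degree (v i))).card)) ∧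
    -- connected induced subgraphs `H = G[S]`, for every embedding `R` of `G` in the sphere
    (∀ R : G.RotationSystem, R.IsPlanar →
      ∀ (S : Finset V) (k : ℕ), (G.induce (S : Set V)).Connected →
        G.InducesCycle (G.nbrSet (S : Set V)) k →
          (k : ℤ) = ∑ v ∈ S, (G.degree v : ℤ)
            - ∑ v : (S : Set V), ((G.induce (S : Set V)).degree v : ℤ)
            - (R.boundaryLength (S : Set V) : ℤ) ∧
          (Even k ↔
            R.boundaryLength (S : Set V) ≡ (S.filter fun v => Odd (G.degree v)).card [MOD 2])) := by
  refine ⟨fun m v k hC => ?_, fun R hR S k hS hC => ?_⟩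
  · obtain ⟨R, hR⟩ := hG.1
    let S : Finset V := Finset.univ.map v.toEmbedding
    have hSv : (S : Set V) = Set.range v := by simp [S]
    rw [← hSv] at hC
    -- An empty path has no neighbours to form `C`; excluding it makes the truncated `m - 1` agree
    -- with the integer one.
    have hm : m ≠ 0 := by
      rintro rfl
      have h0 : G.nbrSet (S : Set V) = ∅ := by
        ext x
        simp [SimpleGraph.nbrSet, S]
      have h1 := hC.ncard_eq
      have h2 := hC.1
      rw [h0, Set.ncard_empty] at h1
      omega
    let e : SimpleGraph.pathGraph m ≃g G.induce (S : Set V) :=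
      { toEquiv := (Equiv.ofInjective v v.injective).trans (Equiv.setCongr hSv.symm)
        map_rel_iff' := v.map_adj_iff }
    have hS : (G.induce (S : Set V)).Preconnected :=
      e.preconnected_iff.1 (SimpleGraph.pathGraph_preconnected m)
    have hfree : ∀ x y z : (S : Set V), G.Adj x y → G.Adj y z → ¬ G.Adj z x := by
      intro x y z hxy hyz hzx
      have h1 := SimpleGraph.pathGraph_adj.1 ((e.symm.map_adj_iff (v := x) (w := y)).2 hxy)
      have h2 := SimpleGraph.pathGraph_adj.1 ((e.symm.map_adj_iff (v := y) (w := z)).2 hyz)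
      have h3 := SimpleGraph.pathGraph_adj.1 ((e.symm.map_adj_iff (v := z) (w := x)).2 hzx)
      omega
    have hdeg : ∑ v : (S : Set V), (G.induce (S : Set V)).degree v = 2 * (m - 1) := by
      rw [← SimpleGraph.dart_card_eq_sum_degrees, ← Nat.card_eq_fintype_card,
        ← Nat.card_congr e.dartEquiv, SimpleGraph.natCard_dart_pathGraph]
    have hsum : ∑ x ∈ S, G.degree x = ∑ i, G.degree (v i) := Finset.sum_map _ _ _
    have key := hG.sum_degree_eq hR hC hS
    rw [hG.card_innerDarts_of_triangleFree hR hC hS hfree, hdeg, hsum] at key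
    refine ⟨?_, ?_⟩
    · rw [← Nat.cast_sum]
      omega
    · rw [← Finset.even_sum_iff_even_card_odd, key]
      rw [Nat.even_iff, Nat.even_iff]
      omega
  · have key := hG.sum_degree_eq hR hC hS.preconnected
    rw [← hG.boundaryLength_eq hR hC] at key
    refine ⟨?_, ?_⟩
    · rw [← Nat.cast_sum, ← Nat.cast_sum]
      omega
    · have h1 := (Finset.even_sum_iff_even_card_odd (s := S) fun v => G.degree v)
      rw [key, SimpleGraph.sum_degrees_eq_twice_card_edges] at h1
      rw [Nat.even_iff, Nat.even_iff] at h1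
      rw [Nat.even_iff, Nat.ModEq]
      omega
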